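/- Let $p$ be a prime, let $\mathbb F$ be a finite extension of $\mathbb F_p(t)$, and let $\mathcal V$ be a smooth, projective, geometrically irreducible variety over $\mathbb F$ with function field $K$. Let $\Omega$ be the set of places of $K$ associated with the irreducible divisors of $\mathcal V$: for such a divisor $v$, the local ring of $\mathcal V$ at the generic point of $v$ is a discrete valuation ring with fraction field $K$; let $|\cdot|_v$ be the corresponding absolute value, $K_v$ the completion of $K$ at $v$ with its $v$-adic topology, and $\mathcal O_v=\{x\in K_v: |x|_v\le 1\}$. Let $\mathbf A_{K,\mathrm{tot}}$ be the restricted direct product of the pairs $(K_v,\mathcal O_v)$ over all $v\in\Omega$, with the restricted product topology, in which $K$ is embedded diagonally. Let $\Omega_1\subseteq\Omega$ be a cofinite subset, and let $\Gamma\subseteq K$ be a set of elements each of which is integral at every place of $\Omega_1$ (i.e. $|x|_v\le 1$ for all $x\in\Gamma$, $v\in\Omega_1$). Let $y=(y_v)_{v\in\Omega}\in\mathbf A_{K,\mathrm{tot}}$ lie in the closure of $\Gamma$ in $\mathbf A_{K,\mathrm{tot}}$. If there is $y_0\in K$ such that $y_v=y_0$ in $K_v$ for all $v\in\Omega_1$,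 then $y_v=y_0$ for all $v\in\Omega$, i.e. $y=y_0$. -/

import Mathlib

open AlgebraicGeometry CategoryTheory
open scoped RestrictedProduct

universe u

section Normality

open TensorProduct Order

/-- An étale domain over an integrally closed domain is integrally closed. -/
theorem etale_isIntegrallyClosed (A S : Type*) [CommRing A] [IsDomain A] [IsIntegrallyClosed A]
    [CommRing S] [IsDomain S] [Algebra A S] [Algebra.Etale A S] : IsIntegrallyClosed S := by
  let L := FractionRing A
  have : Module.Flat A S := inferInstance
  have hinj : Function.Injective (algebraMap A S) :=
    FaithfulSMul.algebraMap_injective A S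
  have hS : Function.Injective (algebraMap S (S ⊗[A] L)) :=
    Algebra.TensorProduct.includeLeft_injective (S := A) (IsFractionRing.injective A L)
  let _ : Algebra L (S ⊗[A] L) := Algebra.TensorProduct.rightAlgebra
  have hloc : IsLocalization (Algebra.algebraMapSubmonoid S (nonZeroDivisors A)) (S ⊗[A] L) :=
    inferInstance
  have hle : Algebra.algebraMapSubmonoid S (nonZeroDivisors A) ≤ nonZeroDivisors S := by
    rintro _ ⟨a, ha, rfl⟩
    exact mem_nonZeroDivisors_of_ne_zero ((map_ne_zero_iff _ hinj).2 (nonZeroDivisors.ne_zero ha))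
  have hdom : IsDomain (S ⊗[A] L) := IsLocalization.isDomain_of_le_nonZeroDivisors (S ⊗[A] L) hle
  have het : Algebra.Etale L (S ⊗[A] L) :=
    Algebra.Etale.of_equiv (Algebra.TensorProduct.commRight A L S)
  have hfin : Module.Finite L (S ⊗[A] L) := Algebra.FormallyUnramified.finite_of_free L (S ⊗[A] L)
  have hfield : IsField (S ⊗[A] L) :=
    isField_of_isIntegral_of_isField' (R := L) (Field.toIsField L)
  let _ := hfield.toField
  have hfrac : IsFractionRing S (S ⊗[A] L) := by
    refine IsFractionRing.of_field S _ fun z ↦ ?_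
    obtain ⟨x, y, rfl⟩ := IsLocalization.exists_mk'_eq (Algebra.algebraMapSubmonoid S (nonZeroDivisors A)) z
    exact ⟨x, y, by
      rw [eq_div_iff, IsLocalization.mk'_spec]
      exact (map_ne_zero_iff _ hS).2 (nonZeroDivisors.ne_zero (hle y.2))⟩
  rw [isIntegrallyClosed_iff (S ⊗[A] L)]
  intro x hx
  obtain ⟨z, hz⟩ := (TensorProduct.toIntegralClosure_bijective_of_smooth
    (R := A) (S := S) (B := L)).2 ⟨x, hx⟩
  obtain rfl : (TensorProduct.toIntegralClosure A S L z : S ⊗[A] L) = x := congrArg Subtype.val hz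
  clear hz
  induction z with
  | zero => exact ⟨0, by simp⟩
  | add a b ha hb =>
    obtain ⟨a', ha'⟩ := ha (Subtype.property _)
    obtain ⟨b', hb'⟩ := hb (Subtype.property _)
    exact ⟨a' + b', by rw [map_add, ha', hb', map_add]; rfl⟩
  | tmul s b =>
    obtain ⟨a, ha⟩ := (isIntegrallyClosed_iff L).1 ‹_› b.2
    refine ⟨algebraMap A S a * s, ?_⟩
    change (algebraMap A S a * s) ⊗ₜ[A] (1 : L) = s ⊗ₜ[A] (b : L)
    rw [← ha, ← Algebra.smul_def, TensorProduct.smul_tmul, Algebra.algebraMap_eq_smul_one]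

/-- A smooth integral scheme over a field is normal. -/
theorem stalk_isIntegrallyClosed {F : Type*} [Field F] {V : Scheme} [IsIntegral V]
    (f : V ⟶ Spec (.of F)) [Smooth f] (x : V) : IsIntegrallyClosed (V.presheaf.stalk x) := by
  obtain ⟨U, hU, W, hW, hxW, e, hs⟩ := Smooth.exists_isStandardSmooth f x
  obtain ⟨n, g, hg, het⟩ := hs.exists_etale_mvPolynomial
  have hne : Nonempty W := ⟨⟨x, hxW⟩⟩
  have hUtop : U = ⊤ := by
    ext y
    have : f x ∈ U := e hxW
    simp only [TopologicalSpace.Opens.coe_top, Set.mem_univ, iff_true]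
    rwa [Subsingleton.elim y (f x)]
  subst hUtop
  have hR : IsField Γ(Spec (.of F), ⊤) :=
    (Scheme.ΓSpecIso (.of F)).commRingCatIsoToRingEquiv.toMulEquiv.isField (Field.toIsField F)
  let _ := hR.toField
  let _ := g.toAlgebra
  have : Algebra.Etale (MvPolynomial (Fin n) Γ(Spec (.of F), ⊤)) Γ(V, W) := het
  have : IsIntegrallyClosed Γ(V, W) := etale_isIntegrallyClosed (MvPolynomial (Fin n) Γ(Spec (.of F), ⊤)) _
  let _ := TopCat.Presheaf.algebra_section_stalk V.presheaf (⟨x, hxW⟩ : W)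
  have := hW.isLocalization_stalk ⟨x, hxW⟩
  exact isIntegrallyClosed_of_isLocalization _ _ (Ideal.primeCompl_le_nonZeroDivisors (hW.primeIdealOf ⟨x, hxW⟩).asIdeal)

/-- Local rings of smooth integral schemes over a field at points of codimension one are
discrete valuation rings. -/
theorem stalk_isDiscreteValuationRing {F : Type*} [Field F] {V : Scheme} [IsIntegral V]
    (f : V ⟶ Spec (.of F)) [Smooth f] (x : V) (hx : coheight x = 1) :
    IsDiscreteValuationRing (V.presheaf.stalk x) := by
  have : IsLocallyNoetherian V := LocallyOfFiniteType.isLocallyNoetherian f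
  have := stalk_isIntegrallyClosed f x
  have hdim : ringKrullDim (V.presheaf.stalk x) = 1 := by
    rw [ringKrullDim_stalk_eq_coheight, hx]; rfl
  have := krullDimLE_of_coheight_le (n := 1) hx.le
  have hf : ¬ IsField (V.presheaf.stalk x) := fun h ↦ by
    rw [ringKrullDim_eq_zero_of_isField h] at hdim
    exact zero_ne_one hdim
  have hd : IsDedekindDomain (V.presheaf.stalk x) :=
    { (inferInstance : IsDomain _), (inferInstance : IsNoetherianRing _),
      (inferInstance : IsIntegrallyClosed _) with
      maximalOfPrime := fun h0 hp ↦ Ring.krullDimLE_one_iff_of_isPrime_bot.1 this _ h0 hp }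
  exact ((IsDiscreteValuationRing.TFAE _ hf).out 2 0).1 hd


/-- A rational function is regular at all but finitely many points of codimension one. -/
theorem finite_codimOne {V : Scheme} [IsIntegral V] [IsNoetherian V] (k : V.functionField) :
    {x : V | coheight x = 1 ∧
      k ∉ Set.range (algebraMap (V.presheaf.stalk x) V.functionField)}.Finite := by
  obtain ⟨U, hU, s, hs⟩ := V.presheaf.exists_germ_eq k
  have : Nonempty U := ⟨⟨_, hU⟩⟩
  have hT : ∀ z : V, z ≤ genericPoint V := fun z ↦ genericPoint_specializes z
  obtain ⟨S, hSf, hSc, hSi, hSU⟩ :=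
    TopologicalSpace.NoetherianSpace.exists_finite_set_isClosed_irreducible
      (U.isOpen.isClosed_compl)
  refine Set.Finite.of_finite_image (f := fun x : V ↦ closure {x}) (hSf.subset ?_) ?_
  · rintro _ ⟨x, ⟨hx1, hxk⟩, rfl⟩
    have hxU : x ∉ U := fun hxU ↦ hxk
      ⟨V.presheaf.germ U x hxU s, by
        rw [Scheme.algebraMap_germ_eq_germToFunctionField]; exact hs⟩
    have hx' : x ∈ ⋃₀ S := hSU ▸ hxU
    obtain ⟨C, hCS, hxC⟩ := hx'
    obtain ⟨η, hη⟩ := QuasiSober.sober (hSi C hCS) (hSc C hCS)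
    have hle : x ≤ η := hη.specializes hxC
    have hηU : η ∉ U := by
      have : η ∈ (U : Set V)ᶜ := hSU ▸ ⟨C, hCS, hη.mem⟩
      exact this
    have hge : η ≤ x := by
      by_contra hn
      have hlt : x < η := lt_of_le_not_ge hle hn
      have h2 : coheight η < coheight x := coheight_strictAnti hlt (by
        have := coheight_anti hle
        rw [hx1] at this
        exact lt_of_le_of_lt this (by simp))
      rw [hx1, Order.lt_one_iff, coheight_eq_zero] at h2
      have h3 : genericPoint V ≤ η := h2 (hT η)
      exact hηU ((Specializes.antisymm (hT η) h3).eq ▸ hU)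
    have : x = η := (Specializes.antisymm hge hle).eq
    change closure {x} ∈ S
    rw [this, hη.def]
    exact hCS
  · intro x _ x' _ h
    exact (inseparable_iff_closure_eq.2 h).eq

end Normality

noncomputable section

section ProjectiveSpace

attribute [local instance] MvPolynomial.gradedAlgebra

/-- Projective `n`-space over a field `F`, as `Proj F[X₀, …, Xₙ]`. -/
def ProjSpace (F : Type u) [Field F] (n : ℕ) : Scheme.{u} :=
  Proj (MvPolynomial.homogeneousSubmodule (Fin (n + 1)) F)

/-- The structure morphism of projective space. -/
def ProjSpace.toSpec (F : Type u) [Field F] (n : ℕ) : ProjSpace F n ⟶ Spec (.of F) :=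
  Proj.toSpecZero (MvPolynomial.homogeneousSubmodule (Fin (n + 1)) F) ≫
    Spec.map (CommRingCat.ofHom
      (algebraMap F (MvPolynomial.homogeneousSubmodule (Fin (n + 1)) F 0)))

instance (F : Type u) [Field F] (n : ℕ) : CompactSpace (ProjSpace F n) := by
  have h : (algebraMap F (MvPolynomial (Fin (n + 1)) F)).FiniteType :=
    RingHom.finiteType_algebraMap.2 inferInstance
  have : Algebra.FiniteType (MvPolynomial.homogeneousSubmodule (Fin (n + 1)) F 0)
      (MvPolynomial (Fin (n + 1)) F) :=
    RingHom.finiteType_algebraMap.1 (RingHom.FiniteType.of_comp_finiteType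
      (f := algebraMap F (MvPolynomial.homogeneousSubmodule (Fin (n + 1)) F 0)) h)
  have : QuasiCompact
      (Proj.toSpecZero (MvPolynomial.homogeneousSubmodule (Fin (n + 1)) F)) := inferInstance
  have h' : CompactSpace (Proj (MvPolynomial.homogeneousSubmodule (Fin (n + 1)) F)) :=
    QuasiCompact.compactSpace_of_compactSpace
      (Proj.toSpecZero (MvPolynomial.homogeneousSubmodule (Fin (n + 1)) F))
  exact h'

end ProjectiveSpace

/-- A smooth, projective, geometrically irreducible variety over the field `F`. -/
structure SmoothProjectiveVariety (F : Type u) [Field F] where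
  /-- the underlying scheme -/
  scheme : Scheme.{u}
  /-- the structure morphism -/
  hom : scheme ⟶ Spec (.of F)
  isIntegral : IsIntegral scheme
  smooth : Smooth hom
  geometricallyIrreducible : GeometricallyIrreducible hom
  projective : ∃ (n : ℕ) (i : scheme ⟶ ProjSpace F n),
    IsClosedImmersion i ∧ i ≫ ProjSpace.toSpec F n = hom

namespace SmoothProjectiveVariety

attribute [instance] isIntegral smooth geometricallyIrreducible

variable {F : Type u} [Field F] (V : SmoothProjectiveVariety F)

instance isNoetherian : IsNoetherian V.scheme := by
  have : IsLocallyNoetherian V.scheme := LocallyOfFiniteType.isLocallyNoetherian V.hom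
  obtain ⟨n, i, hi, -⟩ := V.projective
  have : CompactSpace V.scheme := QuasiCompact.compactSpace_of_compactSpace i
  exact { }

/-- The function field `K` of `V`. -/
abbrev FunctionField : Type u := V.scheme.functionField

/-- The places of `K`: the irreducible divisors of `V`, given by their generic points, which are
the points of codimension one. -/
def Place : Type u := {x : V.scheme // Order.coheight x = 1}

namespace Place

variable {V} (v : V.Place)

/-- The local ring of `V` at the generic point of the divisor `v`. -/
abbrev LocalRing : Type u := V.scheme.presheaf.stalk v.1

instance : IsDiscreteValuationRing v.LocalRing := stalk_isDiscreteValuationRing V.hom v.1 v.2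

/-- The maximal ideal of the local ring at `v`; it carries the valuation "order of vanishing
along `v`" of `K`, written multiplicatively. -/
abbrev prime : IsDedekindDomain.HeightOneSpectrum v.LocalRing :=
  IsDiscreteValuationRing.maximalIdeal v.LocalRing

/-- The normalized discrete valuation of `K` attached to `v`, with values in `ℤᵐ⁰`. -/
abbrev valuation : Valuation V.FunctionField (WithZero (Multiplicative ℤ)) :=
  v.prime.valuation V.FunctionField

/-- The completion `K_v` of `K` at `v`, with the `v`-adic topology. -/
abbrev Completion : Type u := v.prime.adicCompletion V.FunctionField

/-- The ring `𝒪_v` of `v`-adic integers of `K_v`. -/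
abbrev integers : ValuationSubring v.Completion :=
  v.prime.adicCompletionIntegers V.FunctionField

/-- An element of `K` is integral at `v` if `|x|_v ≤ 1`. -/
def IsIntegralAt (x : V.FunctionField) : Prop := v.valuation x ≤ 1

end Place

/-- An element of `K` has only finitely many poles. -/
theorem finite_poles (k : V.FunctionField) : {v : V.Place | ¬ v.IsIntegralAt k}.Finite := by
  refine Set.Finite.of_finite_image (f := Subtype.val) ((finite_codimOne k).subset ?_)
    Subtype.val_injective.injOn
  rintro _ ⟨v, hv, rfl⟩
  refine ⟨v.2, ?_⟩
  rintro ⟨a, rfl⟩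
  exact hv (v.prime.valuation_le_one a)

/-- The adeles `𝐀_{K,tot}`: the restricted product of the `K_v` with respect to the `𝒪_v`, over
all places `v`, with the restricted product topology. -/
abbrev Adele : Type u := Πʳ v : V.Place, [v.Completion, v.integers]

/-- The diagonal embedding of `K` into the adeles. -/
def diagonal : V.FunctionField →+* V.Adele where
  toFun k := ⟨fun _ ↦ k, by
    simp only [Filter.eventually_cofinite, SetLike.mem_coe,
      IsDedekindDomain.HeightOneSpectrum.mem_adicCompletionIntegers,
      IsDedekindDomain.HeightOneSpectrum.valuedAdicCompletion_eq_valuation']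
    exact V.finite_poles k⟩
  map_one' := Subtype.ext <| funext fun _ ↦
    IsDedekindDomain.HeightOneSpectrum.adicCompletion.coe_one ..
  map_mul' _ _ := Subtype.ext <| funext fun _ ↦
    IsDedekindDomain.HeightOneSpectrum.adicCompletion.coe_mul ..
  map_zero' := Subtype.ext <| funext fun _ ↦
    IsDedekindDomain.HeightOneSpectrum.adicCompletion.coe_zero ..
  map_add' _ _ := Subtype.ext <| funext fun _ ↦
    IsDedekindDomain.HeightOneSpectrum.adicCompletion.coe_add ..

end SmoothProjectiveVariety

end

/-! ### Homogeneous Noether normalization -/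

section HomogeneousNoetherNormalization

open MvPolynomial

/-! Suppose `y` and `y₀` differ at a place `v₀`. For `x ∈ Γ` close to `y`, the difference `b = x -
y₀` is integral outside a fixed finite set of places, has poles bounded in advance on that set, and
is as small as desired at a chosen `w ∈ Ω₁`, because `y w = y₀`. A nonzero function with bounded
poles cannot vanish to arbitrarily high order at `w`, so `x = y₀`. But `x` can also be taken closer
to `y` at `v₀` than `y₀` is, a contradiction. This needs a place in `Ω₁`
(`IsNormalizedModel.exists_notMem_finset`) and the bound on the order of vanishing
(`IsNormalizedModel.exists_forall_eq_zero`).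

The bound is transported to projective space. As `F` is infinite, Noether normalization by linear
forms `y i` makes `K` finite over the field `E` of their ratios. A form `G` of degree `k`, vanishing
enough to absorb the permitted poles, makes `c = G b / y i ^ k` integral over the polynomial ring of
the chart `i`. Comparing two charts, the norm of `c` to `E` is a form of degree `k [K : E]` divided
by a power of `y i`, so it lies in a finite-dimensional space independent of `b`. It is also `c`
times an integral element, hence vanishes at `w` at least as much as `b` does. In a
finite-dimensional space enough vanishing forces zero, so `c = 0` and `b = 0`.

Geometry enters only through `IsProjectiveModel`: normality makes a function without polar divisors
on an affine chart regular there, and the closed immersion makes such functions polynomials in the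
coordinate ratios. -/

theorem MvPolynomial.aeval_mul_left_of_isHomogeneous {σ F K : Type*} [CommSemiring F]
    [CommSemiring K] [Algebra F K] {P : MvPolynomial σ F} {k : ℕ} (hP : P.IsHomogeneous k)
    (c : K) (y : σ → K) : aeval (fun i ↦ c * y i) P = c ^ k * aeval y P := by
  rw [aeval_def, aeval_def, eval₂_eq, eval₂_eq, Finset.mul_sum]
  refine Finset.sum_congr rfl fun d hd ↦ ?_
  have h := hP.degree_eq_sum_deg_support hd
  simp only [mul_pow, Finset.prod_mul_distrib, Finset.prod_pow_eq_pow_sum]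
  rw [← h]
  ring

theorem MvPolynomial.eval_mul_left_of_isHomogeneous {σ F : Type*} [CommSemiring F]
    {P : MvPolynomial σ F} {k : ℕ} (hP : P.IsHomogeneous k)
    (c : F) (y : σ → F) : eval (fun i ↦ c * y i) P = c ^ k * eval y P := by
  simpa [aeval_eq_eval] using aeval_mul_left_of_isHomogeneous hP c y

/-- Substituting `a + b T` into a homogeneous polynomial of degree `k` gives a polynomial in `T`
of degree at most `k`, whose coefficient of degree `k` is the value at `b`. -/
theorem MvPolynomial.natDegree_coeff_aeval_linear_of_isHomogeneous {σ F R : Type*} [CommRing F]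
    [CommRing R] [Algebra F R] {P : MvPolynomial σ F} {k : ℕ} (hP : P.IsHomogeneous k)
    (a b : σ → R) :
    (aeval (fun i ↦ Polynomial.C (a i) + Polynomial.C (b i) * Polynomial.X) P).natDegree ≤ k ∧
    (aeval (fun i ↦ Polynomial.C (a i) + Polynomial.C (b i) * Polynomial.X) P).coeff k =
      aeval b P := by
  have key : ∀ (s : Finset σ) (d : σ → ℕ),
      (∏ i ∈ s, (Polynomial.C (a i) + Polynomial.C (b i) * Polynomial.X) ^ d i).natDegree
        ≤ ∑ i ∈ s, d i ∧
      (∏ i ∈ s, (Polynomial.C (a i) + Polynomial.C (b i) * Polynomial.X) ^ d i).coeff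
        (∑ i ∈ s, d i) = ∏ i ∈ s, b i ^ d i := by
    classical
    intro s d
    have hlin : ∀ i, (Polynomial.C (a i) + Polynomial.C (b i) * Polynomial.X).natDegree ≤ 1 :=
      fun i ↦ by compute_degree
    have hpow : ∀ i, ((Polynomial.C (a i) + Polynomial.C (b i) * Polynomial.X) ^ d i).natDegree
        ≤ d i := fun i ↦ by
      simpa using Polynomial.natDegree_pow_le_of_le (d i) (hlin i)
    induction s using Finset.induction_on with
    | empty => simp
    | insert i s hi ih =>
      rw [Finset.prod_insert hi, Finset.sum_insert hi, Finset.prod_insert hi]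
      refine ⟨Polynomial.natDegree_mul_le_of_le (hpow i) ih.1, ?_⟩
      rw [Polynomial.coeff_mul_add_eq_of_natDegree_le (hpow i) ih.1, ih.2]
      congr 1
      have := Polynomial.coeff_pow_of_natDegree_le (m := d i) (hlin i)
      rw [mul_one] at this
      rw [this]
      simp
  rw [aeval_def, eval₂_eq]
  constructor
  · refine Polynomial.natDegree_sum_le_of_forall_le _ _ fun d hd ↦ ?_
    have h := hP.degree_eq_sum_deg_support hd
    rw [Polynomial.algebraMap_apply]
    refine (Polynomial.natDegree_C_mul_le _ _).trans ?_
    rw [h]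
    exact (key _ _).1
  · rw [Polynomial.finsetSum_coeff, aeval_def, eval₂_eq]
    refine Finset.sum_congr rfl fun d hd ↦ ?_
    have h := hP.degree_eq_sum_deg_support hd
    rw [Polynomial.algebraMap_apply, Polynomial.coeff_C_mul, h, (key _ _).2]

theorem isIntegral_of_coeff_isUnit {R S : Type*} [CommRing R] [CommRing S] [Algebra R S]
    {q : Polynomial R} {k : ℕ} (hk : q.natDegree ≤ k) (hu : IsUnit (q.coeff k)) {x : S}
    (hx : Polynomial.aeval x q = 0) : IsIntegral R x := by
  nontriviality R
  have hk' : q.natDegree = k :=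
    le_antisymm hk (Polynomial.le_natDegree_of_ne_zero hu.ne_zero)
  obtain ⟨u, hu⟩ := hu
  refine ⟨Polynomial.C (↑u⁻¹ : R) * q, ?_, ?_⟩
  · refine Polynomial.monic_C_mul_of_mul_leadingCoeff_eq_one ?_
    rw [Polynomial.leadingCoeff, hk', ← hu, Units.inv_mul]
  · rw [Polynomial.eval₂_mul, ← Polynomial.aeval_def x q, hx, mul_zero]

variable {F K : Type*} [Field F] [Field K] [Algebra F K]

/-- Over an infinite field `P` is nonzero at some point `b`, which can be scaled to have `b l = 1`.
Writing each `y i` as `(y i - b i y l) + b i y l` turns the relation into an equation for `y l` with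
leading coefficient the nonzero constant `P(b)`. Homogeneity lets everything be scaled by `c`, so
one choice serves all charts. -/
theorem isIntegral_mul_of_homogeneous_relation [Infinite F] {m : ℕ} (y : Fin (m + 1) → K) {k : ℕ}
    {P : MvPolynomial (Fin (m + 1)) F} (hP : P.IsHomogeneous k) (hP0 : P ≠ 0)
    (hy : aeval y P = 0) :
    ∃ (l : Fin (m + 1)) (a : Fin m → F), ∀ c : K,
      IsIntegral (Algebra.adjoin F (Set.range fun i ↦ c * (y (l.succAbove i) - a i • y l)))
        (c * y l) := by
  obtain ⟨b, hb⟩ : ∃ b, eval b P ≠ 0 := by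
    by_contra! h
    exact hP0 (MvPolynomial.funext fun x ↦ by simp [h x])
  obtain ⟨l, hl⟩ : ∃ l, b l ≠ 0 := by
    by_contra! h
    obtain rfl : b = 0 := funext h
    -- The point `b = 0` is excluded: in degree `0` the form is a constant, killed by `hy`; in
    -- positive degree it vanishes at the origin.
    rcases Nat.eq_zero_or_pos k with rfl | hk
    · obtain ⟨r, rfl⟩ : ∃ r, C r = P := by
        have := (totalDegree_zero_iff_isHomogeneous (p := P)).2 hP
        exact ⟨_, (totalDegree_eq_zero_iff_eq_C.1 this).symm⟩
      simp at hb
      exact hb (by simpa using hy)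
    · have := eval_mul_left_of_isHomogeneous hP 0 0
      rw [zero_pow hk.ne', zero_mul] at this
      exact hb (by simpa using this)
  set b' : Fin (m + 1) → F := fun i ↦ (b l)⁻¹ * b i with hb'
  have hb'l : b' l = 1 := inv_mul_cancel₀ hl
  have hb'0 : eval b' P ≠ 0 := by
    rw [eval_mul_left_of_isHomogeneous hP]
    exact mul_ne_zero (pow_ne_zero _ (inv_ne_zero hl)) hb
  refine ⟨l, fun i ↦ b' (l.succAbove i), fun c ↦ ?_⟩
  set R := Algebra.adjoin F (Set.range fun i ↦ c * (y (l.succAbove i) - b' (l.succAbove i) • y l))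
  have hmem : ∀ i, c * (y i - b' i • y l) ∈ R := fun i ↦ by
    rcases Fin.eq_self_or_eq_succAbove l i with rfl | ⟨j, rfl⟩
    · simp [hb'l]
    · exact Algebra.subset_adjoin ⟨j, rfl⟩
  obtain ⟨h1, h2⟩ := natDegree_coeff_aeval_linear_of_isHomogeneous hP (R := R) (fun i ↦ ⟨_, hmem i⟩)
    (fun i ↦ algebraMap F R (b' i))
  refine isIntegral_of_coeff_isUnit h1 ?_ ?_
  · rw [h2, show (fun i ↦ algebraMap F R (b' i)) = algebraMap F R ∘ b' from rfl,
      aeval_algebraMap_apply, aeval_eq_eval]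
    exact (IsUnit.mk0 _ hb'0).map (algebraMap F R)
  · have h3 : Polynomial.aeval (c * y l) (aeval (fun i ↦ Polynomial.C (⟨_, hmem i⟩ : R) +
        Polynomial.C (algebraMap F R (b' i)) * Polynomial.X) P) =
        aeval (fun i ↦ c * y i) P := by
      have := DFunLike.congr_fun (MvPolynomial.comp_aeval (fun i ↦ Polynomial.C (⟨_, hmem i⟩ : R) +
        Polynomial.C (algebraMap F R (b' i)) * Polynomial.X)
        ((Polynomial.aeval (R := R) (c * y l)).restrictScalars F)) P
      refine this.trans ?_
      congr 2
      funext i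
      simp only [AlgHom.restrictScalars_apply, map_add, map_mul, Polynomial.aeval_C,
        Polynomial.aeval_X]
      rw [← IsScalarTower.algebraMap_apply]
      change c * (y i - b' i • y l) + _ = _
      rw [Algebra.smul_def]
      ring
    rw [h3, aeval_mul_left_of_isHomogeneous hP, hy, mul_zero]

/-- Homogeneous Noether normalization over an infinite field. -/
theorem exists_homogeneous_noether_normalization [Infinite F] {n : ℕ} (s : Fin n → K) :
    ∃ (m : ℕ) (y : Fin m → K), (∀ i, y i ∈ Submodule.span F (Set.range s)) ∧
      (∀ (k : ℕ) (P : MvPolynomial (Fin m) F), P.IsHomogeneous k → aeval y P = 0 → P = 0) ∧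
      ∀ (c : K) (j : Fin n),
        IsIntegral (Algebra.adjoin F (Set.range fun i ↦ c * y i)) (c * s j) := by
  classical
  -- Take a family of least length, starting from `s` itself; a homogeneous relation would eliminate
  -- one more element.
  have hex : ∃ m, ∃ y : Fin m → K, (∀ i, y i ∈ Submodule.span F (Set.range s)) ∧
      ∀ (c : K) (j : Fin n),
        IsIntegral (Algebra.adjoin F (Set.range fun i ↦ c * y i)) (c * s j) :=
    ⟨n, s, fun i ↦ Submodule.subset_span ⟨i, rfl⟩, fun c j ↦
      isIntegral_algebraMap (R := Algebra.adjoin F (Set.range fun i ↦ c * s i))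
        (x := ⟨c * s j, Algebra.subset_adjoin ⟨j, rfl⟩⟩)⟩
  have hmin := fun m ↦ Nat.find_min hex (m := m)
  have hspec := Nat.find_spec hex
  generalize Nat.find hex = m at hmin hspec
  obtain ⟨y, hy1, hy2⟩ := hspec
  refine ⟨m, y, hy1, fun k P hP hPy ↦ ?_, hy2⟩
  by_contra hP0
  cases m with
  | zero =>
    refine hP0 ?_
    obtain ⟨r, rfl⟩ := C_surjective (Fin 0) P
    simpa using hPy
  | succ m =>
    obtain ⟨l, a, hl⟩ := isIntegral_mul_of_homogeneous_relation y hP hP0 hPy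
    refine hmin m (Nat.lt_succ_self m) ⟨fun i ↦ y (l.succAbove i) - a i • y l,
      fun i ↦ Submodule.sub_mem _ (hy1 _) (Submodule.smul_mem _ _ (hy1 _)), fun c j ↦ ?_⟩
    set R := Algebra.adjoin F (Set.range fun i ↦ c * (y (l.succAbove i) - a i • y l))
    have hint : ∀ i, IsIntegral R (c * y i) := fun i ↦ by
      rcases Fin.eq_self_or_eq_succAbove l i with rfl | ⟨i, rfl⟩
      · exact hl c
      · have h1 : IsIntegral R (c * (y (l.succAbove i) - a i • y l)) :=
          isIntegral_algebraMap (R := R) (x := ⟨_, Algebra.subset_adjoin ⟨i, rfl⟩⟩)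
        have h2 : IsIntegral R (a i • (c * y l)) := (hl c).smul (a i)
        have := h1.add h2
        rwa [mul_sub, mul_smul_comm, sub_add_cancel] at this
    have hle : Algebra.adjoin F (Set.range fun i ↦ c * y i) ≤
        (integralClosure R K).restrictScalars F :=
      Algebra.adjoin_le (by rintro _ ⟨i, rfl⟩; exact hint i)
    have h3 : IsIntegral (integralClosure R K) (c * s j) := by
      obtain ⟨p, hp1, hp2⟩ := hy2 c j
      let f : Algebra.adjoin F (Set.range fun i ↦ c * y i) →+* integralClosure R K :=
        (Subalgebra.inclusion hle).toRingHom
      refine ⟨p.map f, hp1.map _, ?_⟩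
      rw [Polynomial.eval₂_map]
      exact hp2
    exact isIntegral_trans (R := R) (A := integralClosure R K) _ h3

end HomogeneousNoetherNormalization

/-! ### Homogeneous coordinates and charts of projective space -/

section Homogenization

open MvPolynomial

variable {σ F : Type*} [Field F]

/-- The homogenization of a polynomial with respect to one of its variables. -/
noncomputable def MvPolynomial.homogenizeAt (i : σ) (Q : MvPolynomial σ F) : MvPolynomial σ F :=
  ∑ d ∈ Finset.range (Q.totalDegree + 1), homogeneousComponent d Q * X i ^ (Q.totalDegree - d)

theorem MvPolynomial.isHomogeneous_homogenizeAt (i : σ) (Q : MvPolynomial σ F) :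
    (homogenizeAt i Q).IsHomogeneous Q.totalDegree := by
  refine IsHomogeneous.sum _ _ _ fun d hd ↦ ?_
  have h := (homogeneousComponent_isHomogeneous d Q).mul
    ((isHomogeneous_X F i).pow (Q.totalDegree - d))
  have h2 : d + 1 * (Q.totalDegree - d) = Q.totalDegree := by
    have := Finset.mem_range.1 hd
    omega
  rwa [h2] at h

theorem MvPolynomial.aeval_homogenizeAt {S : Type*} [CommRing S] [Algebra F S] (i : σ)
    (Q : MvPolynomial σ F) (u : σ → S) (hu : u i = 1) :
    aeval u (homogenizeAt i Q) = aeval u Q := by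
  conv_rhs => rw [← sum_homogeneousComponent Q]
  simp [homogenizeAt, hu]

variable {K : Type*} [Field K] [Algebra F K] {y : σ → K}

/-- Elements of `K` that satisfy no homogeneous relation over `F`. -/
def HomogeneouslyIndependent (F : Type*) [Field F] [Algebra F K] (y : σ → K) : Prop :=
  ∀ (k : ℕ) (P : MvPolynomial σ F), P.IsHomogeneous k → aeval y P = 0 → P = 0

namespace HomogeneouslyIndependent

theorem ne_zero (hy : HomogeneouslyIndependent F y) (i : σ) : y i ≠ 0 := fun h ↦
  X_ne_zero (R := F) i (hy 1 _ (isHomogeneous_X F i) (by simpa using h))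

/-- A relation between the ratios homogenizes to one between the `y j`; setting the variable `i` to
`1` recovers the original polynomial, which is therefore zero. -/
theorem algebraicIndependent (hy : HomogeneouslyIndependent F y) (i : σ) :
    AlgebraicIndependent F (fun j : {j // j ≠ i} ↦ (y i)⁻¹ * y j) := by
  classical
  rw [algebraicIndependent_iff]
  intro Q hQ
  set Q' : MvPolynomial σ F := rename Subtype.val Q with hQ'
  have h1 : aeval (fun j ↦ (y i)⁻¹ * y j) Q' = 0 := by
    rw [hQ', aeval_rename]; exact hQ
  rw [← aeval_homogenizeAt i Q' _ (inv_mul_cancel₀ (hy.ne_zero i)),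
    aeval_mul_left_of_isHomogeneous (isHomogeneous_homogenizeAt i Q')] at h1
  have h2 := hy _ _ (isHomogeneous_homogenizeAt i Q')
    ((mul_eq_zero.1 h1).resolve_left (pow_ne_zero _ (inv_ne_zero (hy.ne_zero i))))
  have h3 := aeval_homogenizeAt i Q'
    (fun j ↦ if h : j ≠ i then (X ⟨j, h⟩ : MvPolynomial {j // j ≠ i} F) else 1) (by simp)
  rw [h2, map_zero, hQ', aeval_rename] at h3
  rw [h3]
  conv_lhs => rw [← aeval_X_left_apply Q]
  congr 2
  funext j
  simp [j.2]

theorem adjoin_eq (hy : HomogeneouslyIndependent F y) (i : σ) :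
    Algebra.adjoin F (Set.range fun j : {j // j ≠ i} ↦ (y i)⁻¹ * y j) =
      Algebra.adjoin F (Set.range fun j ↦ (y i)⁻¹ * y j) := by
  apply le_antisymm
  · refine Algebra.adjoin_mono ?_
    rintro _ ⟨j, rfl⟩
    exact ⟨j, rfl⟩
  · refine Algebra.adjoin_le ?_
    rintro _ ⟨j, rfl⟩
    by_cases h : j = i
    · subst h
      simp [inv_mul_cancel₀ (hy.ne_zero j), one_mem]
    · exact Algebra.subset_adjoin ⟨⟨j, h⟩, rfl⟩

theorem isIntegrallyClosed_adjoin (hy : HomogeneouslyIndependent F y) (i : σ) :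
    IsIntegrallyClosed (Algebra.adjoin F (Set.range fun j ↦ (y i)⁻¹ * y j)) := by
  rw [← hy.adjoin_eq i]
  exact IsIntegrallyClosed.of_equiv (hy.algebraicIndependent i).aevalEquiv.toRingEquiv

theorem exists_eq_algebraMap_of_isUnit (hy : HomogeneouslyIndependent F y) (i : σ)
    {z : Algebra.adjoin F (Set.range fun j ↦ (y i)⁻¹ * y j)} (hz : IsUnit z) :
    ∃ a : F, (z : K) = algebraMap F K a := by
  obtain ⟨z, hzR⟩ := z
  revert hz hzR
  rw [← hy.adjoin_eq i]
  intro hzR hz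
  let e := (hy.algebraicIndependent i).aevalEquiv
  obtain ⟨a, -, ha⟩ := isUnit_iff_eq_C_of_isReduced.1 (hz.map e.symm)
  refine ⟨a, ?_⟩
  have h1 := congrArg e ha
  rw [AlgEquiv.apply_symm_apply, ← algebraMap_eq, e.commutes] at h1
  exact congrArg Subtype.val h1

theorem exists_eq_of_mem_adjoin (hy : HomogeneouslyIndependent F y) (i : σ) {z : K}
    (hz : z ∈ Algebra.adjoin F (Set.range fun j ↦ (y i)⁻¹ * y j)) :
    ∃ (k : ℕ) (P : MvPolynomial σ F), P.IsHomogeneous k ∧ z = (y i)⁻¹ ^ k * aeval y P := by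
  rw [Algebra.adjoin_range_eq_range_aeval] at hz
  obtain ⟨Q, rfl⟩ := hz
  refine ⟨_, _, isHomogeneous_homogenizeAt i Q, ?_⟩
  rw [← aeval_mul_left_of_isHomogeneous (isHomogeneous_homogenizeAt i Q),
    aeval_homogenizeAt i Q _ (inv_mul_cancel₀ (hy.ne_zero i))]
  rfl

theorem eq_of_aeval_eq (hy : HomogeneouslyIndependent F y) {k : ℕ} {P Q : MvPolynomial σ F}
    (hP : P.IsHomogeneous k) (hQ : Q.IsHomogeneous k) (h : aeval y P = aeval y Q) : P = Q :=
  sub_eq_zero.1 (hy k _ (hP.sub hQ) (by rw [map_sub, h, sub_self]))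

/-- A function that is regular on one chart and has a pole of order at most `k` on another chart
is a form of degree `k`. -/
theorem exists_eq_of_mem_adjoin_of_mem_adjoin (hy : HomogeneouslyIndependent F y) {i j : σ}
    (hij : i ≠ j) {z : K} {k : ℕ}
    (hzi : z ∈ Algebra.adjoin F (Set.range fun l ↦ (y i)⁻¹ * y l))
    (hzj : z * ((y j)⁻¹ * y i) ^ k ∈ Algebra.adjoin F (Set.range fun l ↦ (y j)⁻¹ * y l)) :
    ∃ P : MvPolynomial σ F, P.IsHomogeneous k ∧ z = (y i)⁻¹ ^ k * aeval y P := by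
  obtain ⟨a, P, hP, hzP⟩ := hy.exists_eq_of_mem_adjoin i hzi
  obtain ⟨b, Q, hQ, hzQ⟩ := hy.exists_eq_of_mem_adjoin j hzj
  have hi := hy.ne_zero i
  have hj := hy.ne_zero j
  rcases le_total a k with hak | hka
  · refine ⟨P * X i ^ (k - a), ?_, ?_⟩
    · have h := hP.mul ((isHomogeneous_X F i).pow (k - a))
      rwa [one_mul, Nat.add_sub_cancel' hak] at h
    · obtain ⟨e, rfl⟩ := Nat.exists_eq_add_of_le hak
      rw [hzP, Nat.add_sub_cancel_left, map_mul, map_pow, aeval_X, pow_add, inv_pow, inv_pow]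
      field_simp
  · obtain ⟨e, rfl⟩ := Nat.exists_eq_add_of_le hka
    have h1 : aeval y (P * X j ^ b) = aeval y (Q * X i ^ e * X j ^ k) := by
      simp only [map_mul, map_pow, aeval_X]
      rw [hzP, pow_add] at hzQ
      simp only [mul_pow, inv_pow] at hzQ
      field_simp at hzQ
      linear_combination hzQ
    have h2 : P * X j ^ b = Q * X i ^ e * X j ^ k := by
      refine hy.eq_of_aeval_eq (k := b + e + k) ?_ ?_ h1
      · convert hP.mul ((isHomogeneous_X F j).pow b) using 1; ring
      · convert (hQ.mul ((isHomogeneous_X F i).pow e)).mul ((isHomogeneous_X F j).pow k) using 1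
        ring
    -- The excess power of `X i` in the denominator cancels, since `X i` is prime and does not
    -- divide `X j`. This is where two charts suffice.
    have h3 : X i ^ e ∣ P := by
      have hprime : Prime (X i : MvPolynomial σ F) := X_prime
      have : X i ^ e ∣ P * X j ^ b := h2 ▸ Dvd.intro_left (Q * X j ^ k) (by ring)
      refine hprime.pow_dvd_of_dvd_mul_right e (fun h ↦ ?_) this
      have := hprime.dvd_of_dvd_pow h
      rw [X_dvd_X] at this
      exact hij this
    obtain ⟨P', rfl⟩ := h3
    refine ⟨P', fun d hd ↦ ?_, ?_⟩
    · rw [X_pow_eq_monomial] at hP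
      have h4 := hP (d := Finsupp.single i e + d) (by rwa [coeff_monomial_mul, one_mul])
      rw [map_add, Finsupp.weight_single] at h4
      simp only [Pi.one_apply, smul_eq_mul, mul_one] at h4
      omega
    · rw [hzP, map_mul, map_pow, aeval_X, pow_add, inv_pow, inv_pow]
      field_simp

end HomogeneouslyIndependent

end Homogenization

/-! ### Norms of integral elements -/

section Norm

variable {F K : Type*} [Field F] [Field K] [Algebra F K]

open IntermediateField.algebraAdjoinAdjoin in
/-- The norm of an integral element lies in the base and is a multiple of the element. -/
theorem exists_norm_eq_mul {S : Set K} [IsIntegrallyClosed (Algebra.adjoin F S)]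
    {E : IntermediateField F K} (hE : E = IntermediateField.adjoin F S) [FiniteDimensional E K]
    {c : K} (hc : IsIntegral (Algebra.adjoin F S) c) :
    (Algebra.norm E c : K) ∈ Algebra.adjoin F S ∧
      ∃ b, IsIntegral (Algebra.adjoin F S) b ∧ (Algebra.norm E c : K) = c * b := by
  subst hE
  set R := Algebra.adjoin F S
  set E := IntermediateField.adjoin F S
  set p := minpoly R c with hp
  have hmap : minpoly E c = p.map (algebraMap R E) :=
    minpoly.isIntegrallyClosed_eq_field_fractions E K hc
  have hE : IsIntegral E c := hc.tower_top
  set f := Module.finrank (IntermediateField.adjoin E {c}) K with hf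
  have hf0 : 0 < f := Module.finrank_pos
  -- The norm is a power of the constant coefficient of the minimal polynomial, up to sign, and that
  -- polynomial has coefficients in `R` because `R` is integrally closed.
  have hN : (Algebra.norm E c : K) = (((-1) ^ p.natDegree * p.coeff 0 : R) : K) ^ f := by
    rw [Algebra.norm_eq_norm_adjoin, ← hf]
    have h1 := Algebra.PowerBasis.norm_gen_eq_coeff_zero_minpoly
      (IntermediateField.adjoin.powerBasis hE)
    rw [IntermediateField.adjoin.powerBasis_gen, IntermediateField.minpoly_gen,
      IntermediateField.adjoin.powerBasis_dim, hmap, Polynomial.coeff_map,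
      (minpoly.monic hc).natDegree_map] at h1
    rw [h1]
    push_cast
    rfl
  -- From `p = X * p.divX + p(0)` evaluated at `c`: the constant coefficient is a multiple of `c`.
  have h0 : ((p.coeff 0 : R) : K) = c * -Polynomial.aeval c p.divX := by
    have h1 := minpoly.aeval R c
    rw [← hp, ← Polynomial.divX_mul_X_add p, map_add, map_mul, Polynomial.aeval_X,
      Polynomial.aeval_C] at h1
    change _ + ((p.coeff 0 : R) : K) = 0 at h1
    linear_combination h1
  refine ⟨hN ▸ (((-1) ^ p.natDegree * p.coeff 0 : R) ^ f).2,
    -Polynomial.aeval c p.divX * (((-1) ^ p.natDegree : R) : K) *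
      (((-1) ^ p.natDegree * p.coeff 0 : R) : K) ^ (f - 1), ?_, ?_⟩
  · have h1 : ∀ r : R, IsIntegral R (r : K) := fun r ↦ isIntegral_algebraMap (R := R) (x := r)
    refine ((IsIntegral.neg ?_).mul (h1 _)).mul ((h1 _).pow _)
    exact (Polynomial.aeval_mem_adjoin_singleton _ _ : _ ∈ Algebra.adjoin R {c}) |>
      fun h ↦ (Algebra.adjoin_le (S := integralClosure R K) (Set.singleton_subset_iff.2 hc)) h
  · rw [hN, ← Nat.succ_pred_eq_of_pos hf0]
    simp only [Nat.succ_eq_add_one, Nat.add_sub_cancel, pow_succ, Nat.pred_eq_sub_one]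
    push_cast
    rw [h0]
    ring

end Norm

/-! ### Valuations that are trivial on the constants -/

section Valuation

open MvPolynomial WithZero

variable {F K : Type*} [Field F] [Field K] [Algebra F K]

theorem exists_pow_mul_le_one {t : ℤᵐ⁰} (ht : t < 1) (C : ℤᵐ⁰) : ∃ n : ℕ, t ^ n * C ≤ 1 := by
  rcases eq_or_ne C 0 with rfl | hC
  · exact ⟨0, by simp⟩
  · obtain ⟨n, hn⟩ := exists_pow_lt₀ ht (Units.mk0 C⁻¹ (inv_ne_zero hC))
    refine ⟨n, ?_⟩
    calc t ^ n * C ≤ C⁻¹ * C := mul_le_mul_left hn.le C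
      _ = 1 := inv_mul_cancel₀ hC

namespace Valuation

variable {v : Valuation K ℤᵐ⁰} (hF : ∀ a : F, v (algebraMap F K a) ≤ 1)

include hF

theorem le_of_mem_span {S : Set K} {t : ℤᵐ⁰} (hS : ∀ x ∈ S, v x ≤ t) {z : K}
    (hz : z ∈ Submodule.span F S) : v z ≤ t := by
  induction hz using Submodule.span_induction with
  | mem x hx => exact hS x hx
  | zero => simp
  | add x y _ _ hx hy => exact v.map_add_le hx hy
  | smul a x _ hx =>
    rw [Algebra.smul_def, map_mul]
    exact (mul_le_mul' (hF a) hx).trans_eq (one_mul t)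

theorem aeval_le_pow {σ : Type*} {y : σ → K} {t : ℤᵐ⁰} (hy : ∀ i, v (y i) ≤ t) {k : ℕ}
    {P : MvPolynomial σ F} (hP : P.IsHomogeneous k) : v (aeval y P) ≤ t ^ k := by
  rw [aeval_def, eval₂_eq]
  refine v.map_sum_le fun d hd ↦ ?_
  rw [map_mul, map_prod, hP.degree_eq_sum_deg_support hd, ← Finset.prod_pow_eq_pow_sum]
  refine (mul_le_mul' (hF _) (Finset.prod_le_prod' fun i _ ↦ ?_)).trans_eq (one_mul _)
  rw [map_pow]
  exact pow_le_pow_left' (hy i) _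

theorem le_one_of_mem_adjoin {S : Set K} (hS : ∀ x ∈ S, v x ≤ 1) {z : K}
    (hz : z ∈ Algebra.adjoin F S) : v z ≤ 1 := by
  induction hz using Algebra.adjoin_induction with
  | mem x hx => exact hS x hx
  | algebraMap a => exact hF a
  | add x y _ _ hx hy => exact v.map_add_le hx hy
  | mul x y _ _ hx hy => rw [map_mul]; exact mul_le_one' hx hy

omit hF in
theorem le_one_of_isIntegral {A : Type*} [CommRing A] [Algebra A K]
    (hA : ∀ a : A, v (algebraMap A K a) ≤ 1) {z : K} (hz : IsIntegral A z) : v z ≤ 1 := by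
  obtain ⟨p, hp, hpz⟩ := hz
  have : IsIntegral v.integer z := by
    refine ⟨p.map ((algebraMap A K).codRestrict v.integer hA), hp.map _, ?_⟩
    rw [Polynomial.eval₂_map]
    exact hpz
  exact (Valuation.integer.integers v).mem_of_integral this

theorem eq_one_of_ne_zero {a : F} (ha : a ≠ 0) : v (algebraMap F K a) = 1 := by
  refine le_antisymm (hF a) ?_
  have h := hF a⁻¹
  rw [map_inv₀, map_inv₀] at h
  have h0 : v (algebraMap F K a) ≠ 0 := by simpa using ha
  exact (inv_le_one₀ (zero_lt_iff.2 h0)).1 h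

/-- On a finite-dimensional space of functions, a high order of vanishing forces vanishing. -/
theorem exists_forall_mem_eq_zero (W : Submodule F K) [FiniteDimensional F W] :
    ∃ N : ℕ, ∀ x ∈ W, v x ≤ exp (-(N : ℤ)) → x = 0 := by
  -- The subspaces of elements vanishing to order at least `N` decrease, hence stabilize; a nonzero
  -- element of the stable one would have infinite order.
  let W' : ℕ →o (Submodule F W)ᵒᵈ :=
    { toFun N := OrderDual.toDual
        { carrier := {x | v x ≤ exp (-(N : ℤ))}
          add_mem' := fun hx hy ↦ v.map_add_le hx hy
          zero_mem' := by simp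
          smul_mem' := fun a x hx ↦ by
            simp only [Set.mem_ofPred_eq, SetLike.val_smul, Algebra.smul_def, map_mul] at hx ⊢
            exact (mul_le_mul' (hF a) hx).trans_eq (one_mul _) }
      monotone' := fun M N h x (hx : v x ≤ _) ↦ hx.trans (exp_le_exp.2 (by omega)) }
  obtain ⟨N, hN⟩ := IsArtinian.monotone_stabilizes W'
  refine ⟨N, fun x hxW hx ↦ ?_⟩
  by_contra hx0
  have hv : v x ≠ 0 := by simpa using hx0
  have key : ∀ M : ℕ, N ≤ M → v x ≤ exp (-(M : ℤ)) := fun M hM ↦ by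
    have h1 : (⟨x, hxW⟩ : W) ∈ OrderDual.ofDual (W' N) := hx
    rw [hN M hM] at h1
    exact h1
  rw [← exp_log hv] at key
  have := exp_le_exp.1 (key (N + (log (v x)).natAbs + 1) (by omega))
  push_cast at this
  have := neg_abs_le (log (v x))
  omega

end Valuation

end Valuation

/-! ### Projective models and functions with bounded poles -/

section Model

open MvPolynomial WithZero

variable {F K Ω : Type*} [Field F] [Field K] [Algebra F K]

/-- A family of valuations of `K`, trivial on `F` and nontrivial on `K`, together with homogeneous
coordinates of a projective model of `K` on whose affine charts a function is regular as soon as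
it is integral at all the valuations that are centred on that chart. -/
structure IsProjectiveModel (F : Type*) [Field F] [Algebra F K] (v : Ω → Valuation K ℤᵐ⁰) {n : ℕ}
    (s : Fin n → K) : Prop where
  map_le_one : ∀ ω (a : F), v ω (algebraMap F K a) ≤ 1
  nontrivial : ∀ ω, ∃ x, 1 < v ω x
  ne_zero : ∃ j, s j ≠ 0
  adjoin_eq_top : ∀ ℓ ∈ Submodule.span F (Set.range s), ℓ ≠ 0 →
    IntermediateField.adjoin F (Set.range fun j ↦ ℓ⁻¹ * s j) = ⊤
  mem_adjoin : ∀ ℓ ∈ Submodule.span F (Set.range s), ℓ ≠ 0 → ∀ b : K,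
    (∀ ω, (∀ j, v ω (s j) ≤ v ω ℓ) → v ω b ≤ 1) →
      b ∈ Algebra.adjoin F (Set.range fun j ↦ ℓ⁻¹ * s j)

/-- The field of rational functions in the homogeneous coordinates `y`. -/
def ratioField (F : Type*) [Field F] [Algebra F K] {m : ℕ} (y : Fin m → K) :
    IntermediateField F K :=
  IntermediateField.adjoin F (Set.range fun p : Fin m × Fin m ↦ (y p.1)⁻¹ * y p.2)

theorem ratioField_eq {m : ℕ} {y : Fin m → K} (i : Fin m) (hi : y i ≠ 0) :
    ratioField F y = IntermediateField.adjoin F (Set.range fun j ↦ (y i)⁻¹ * y j) := by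
  apply le_antisymm
  · refine IntermediateField.adjoin_le_iff.2 ?_
    rintro _ ⟨⟨p, q⟩, rfl⟩
    have h : ∀ j, (y i)⁻¹ * y j ∈
        IntermediateField.adjoin F (Set.range fun j ↦ (y i)⁻¹ * y j) :=
      fun j ↦ IntermediateField.subset_adjoin _ _ ⟨j, rfl⟩
    have : (y p)⁻¹ * y q = ((y i)⁻¹ * y p)⁻¹ * ((y i)⁻¹ * y q) := by
      rw [mul_inv, inv_inv]
      field_simp
    change (y p)⁻¹ * y q ∈ _
    rw [this]
    exact mul_mem (inv_mem (h p)) (h q)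
  · refine IntermediateField.adjoin.mono _ _ _ ?_
    rintro _ ⟨j, rfl⟩
    exact ⟨(i, j), rfl⟩

/-- Homogeneous coordinates `y` that exhibit `K` as a finite extension of the function field of
projective space, such that a function is integral over the coordinate ring of a standard chart
of projective space as soon as it is integral at all the valuations centred over that chart. -/
structure IsNormalizedModel (F : Type*) [Field F] [Algebra F K] (v : Ω → Valuation K ℤᵐ⁰) {m : ℕ}
    (y : Fin m → K) : Prop where
  map_le_one : ∀ ω (a : F), v ω (algebraMap F K a) ≤ 1
  nontrivial : ∀ ω, ∃ x, 1 < v ω x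
  indep : HomogeneouslyIndependent F y
  finite : FiniteDimensional (ratioField F y) K
  isIntegral : ∀ i (b : K), (∀ ω, (∀ j, v ω (y j) ≤ v ω (y i)) → v ω b ≤ 1) →
    IsIntegral (Algebra.adjoin F (Set.range fun j ↦ (y i)⁻¹ * y j)) b

theorem IsIntegral.of_subalgebra_le {R S : Subalgebra F K} (h : R ≤ S) {x : K}
    (hx : IsIntegral R x) : IsIntegral S x := by
  obtain ⟨p, hp, hpx⟩ := hx
  refine ⟨p.map (Subalgebra.inclusion h).toRingHom, hp.map _, ?_⟩
  rw [Polynomial.eval₂_map]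
  exact hpx

/-- The normalization makes the ratios `s j / ℓ`, which generate `K`, integral over the field of
ratios of the `y i`, so `K` is finite over it. Since each `y j` is a linear combination of the `s
j`, a place centred on the chart `y i ≠ 0` of the model is centred over the corresponding chart
below. -/
theorem IsProjectiveModel.exists_isNormalizedModel [Infinite F] {v : Ω → Valuation K ℤᵐ⁰} {n : ℕ}
    {s : Fin n → K} (h : IsProjectiveModel F v s) :
    ∃ (m : ℕ) (y : Fin m → K), IsNormalizedModel F v y := by
  obtain ⟨m, y, hspan, hind, hint⟩ := exists_homogeneous_noether_normalization (F := F) s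
  refine ⟨m, y, h.map_le_one, h.nontrivial, hind, ?_, fun i b hb ↦ ?_⟩
  · obtain ⟨ℓ, hℓ, hℓ0, hle⟩ : ∃ ℓ ∈ Submodule.span F (Set.range s), ℓ ≠ 0 ∧
        Algebra.adjoin F (Set.range fun i ↦ ℓ⁻¹ * y i) ≤ (ratioField F y).toSubalgebra := by
      -- If `m = 0` the ratio field is just the constants, and any nonzero `s j` serves as
      -- denominator.
      rcases isEmpty_or_nonempty (Fin m) with hm | ⟨⟨i⟩⟩
      · obtain ⟨j, hj⟩ := h.ne_zero
        refine ⟨s j, Submodule.subset_span ⟨j, rfl⟩, hj, ?_⟩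
        simp [Set.range_eq_empty]
      · refine ⟨y i, hspan i, HomogeneouslyIndependent.ne_zero hind i, Algebra.adjoin_le ?_⟩
        rintro _ ⟨j, rfl⟩
        exact IntermediateField.subset_adjoin _ _ ⟨(i, j), rfl⟩
    have hfin : FiniteDimensional (ratioField F y)
        (IntermediateField.adjoin (ratioField F y) (Set.range fun j ↦ ℓ⁻¹ * s j)) := by
      refine IntermediateField.finiteDimensional_adjoin ?_
      rintro _ ⟨j, rfl⟩
      exact (hint ℓ⁻¹ j).of_subalgebra_le hle
    have htop : IntermediateField.adjoin (ratioField F y) (Set.range fun j ↦ ℓ⁻¹ * s j) = ⊤ := by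
      have h1 : IntermediateField.adjoin F (Set.range fun j ↦ ℓ⁻¹ * s j) ≤
          (IntermediateField.adjoin (ratioField F y)
            (Set.range fun j ↦ ℓ⁻¹ * s j)).restrictScalars F :=
        IntermediateField.adjoin_le_iff.2 (IntermediateField.subset_adjoin _ _)
      rw [h.adjoin_eq_top ℓ hℓ hℓ0] at h1
      exact eq_top_iff.2 fun x _ ↦ h1 (IntermediateField.mem_top (x := x))
    rw [htop] at hfin
    exact (IntermediateField.topEquiv (F := ratioField F y) (E := K)).toLinearEquiv.finiteDimensional
  · have hi := HomogeneouslyIndependent.ne_zero hind i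
    have h1 := h.mem_adjoin (y i) (hspan i) hi b fun ω hω ↦ hb ω fun j ↦
      Valuation.le_of_mem_span (h.map_le_one ω) (by rintro _ ⟨j, rfl⟩; exact hω j) (hspan j)
    have hle : Algebra.adjoin F (Set.range fun j ↦ (y i)⁻¹ * s j) ≤
        (integralClosure (Algebra.adjoin F (Set.range fun j ↦ (y i)⁻¹ * y j)) K).restrictScalars F :=
      Algebra.adjoin_le (by rintro _ ⟨j, rfl⟩; exact hint _ j)
    exact hle h1

namespace IsNormalizedModel

variable {v : Ω → Valuation K ℤᵐ⁰} {m : ℕ} {y : Fin m → K} (h : IsNormalizedModel F v y)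

include h

/-- Otherwise the valuation would be trivial on the ratio field, hence on its algebraic extension
`K`. -/
theorem exists_mem_ratioField_lt_one (ω : Ω) : ∃ e ∈ ratioField F y, e ≠ 0 ∧ v ω e < 1 := by
  by_contra! hc
  obtain ⟨x, hx⟩ := h.nontrivial ω
  have := h.finite
  refine hx.not_ge (Valuation.le_one_of_isIntegral (A := ratioField F y) (fun e ↦ ?_)
    (Algebra.IsIntegral.isIntegral x))
  by_contra! he
  have he0 : (e : K) ≠ 0 := fun h0 ↦ by
    rw [show algebraMap (ratioField F y) K e = e from rfl, h0, map_zero] at he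
    exact not_lt_zero he
  have := hc (e : K)⁻¹ (inv_mem e.2) (inv_ne_zero he0)
  rw [map_inv₀] at this
  exact (inv_lt_one_of_one_lt₀ he).not_ge this

/-- With a single coordinate the ratio field consists of constants, on which the valuation is
trivial. The second index supplies the second chart for the norm argument. -/
theorem exists_ne (ω : Ω) (i : Fin m) : ∃ j, j ≠ i := by
  by_contra! hc
  obtain ⟨e, he, he0, hlt⟩ := h.exists_mem_ratioField_lt_one ω
  have hbot : ratioField F y ≤ ⊥ := by
    refine IntermediateField.adjoin_le_iff.2 ?_
    rintro _ ⟨⟨p, q⟩, rfl⟩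
    obtain rfl := (hc p).trans (hc q).symm
    change (y p)⁻¹ * y p ∈ (⊥ : IntermediateField F K)
    rw [inv_mul_cancel₀ (h.indep.ne_zero p)]
    exact one_mem _
  obtain ⟨a, rfl⟩ := IntermediateField.mem_bot.1 (hbot he)
  exact hlt.ne (Valuation.eq_one_of_ne_zero (h.map_le_one ω) (by simpa using he0))

theorem nonempty (ω : Ω) : Nonempty (Fin m) := by
  by_contra! hc
  obtain ⟨e, he, he0, hlt⟩ := h.exists_mem_ratioField_lt_one ω
  have hbot : ratioField F y ≤ ⊥ := by simp [ratioField, Set.range_eq_empty]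
  obtain ⟨a, rfl⟩ := IntermediateField.mem_bot.1 (hbot he)
  exact hlt.ne (Valuation.eq_one_of_ne_zero (h.map_le_one ω) (by simpa using he0))

theorem exists_chart (ω : Ω) : ∃ i, ∀ j, v ω (y j) ≤ v ω (y i) :=
  have := h.nonempty ω
  Finite.exists_max fun j ↦ v ω (y j)

/-- Write an element of the ratio field of value less than `1` as a quotient of two forms of equal
degree. The denominator has at most the generic size `v ω (y i) ^ k`, so the numerator is strictly
smaller. -/
theorem exists_form_lt (ω : Ω) : ∃ (k : ℕ) (P : MvPolynomial (Fin m) F), P.IsHomogeneous k ∧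
    aeval y P ≠ 0 ∧ ∀ i, (∀ j, v ω (y j) ≤ v ω (y i)) → v ω (aeval y P) < v ω (y i) ^ k := by
  obtain ⟨i, -⟩ := h.exists_chart ω
  obtain ⟨e, he, he0, hlt⟩ := h.exists_mem_ratioField_lt_one ω
  have hi := h.indep.ne_zero i
  rw [ratioField_eq i hi, IntermediateField.mem_adjoin_iff_div] at he
  obtain ⟨a, ha, b, hb, rfl⟩ := he
  obtain ⟨k, P, hP, rfl⟩ := h.indep.exists_eq_of_mem_adjoin i ha
  obtain ⟨l, Q, hQ, rfl⟩ := h.indep.exists_eq_of_mem_adjoin i hb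
  have hP0 : aeval y P ≠ 0 := fun h0 ↦ he0 (by simp [h0])
  have hQ0 : aeval y Q ≠ 0 := fun h0 ↦ he0 (by simp [h0])
  refine ⟨k + l, P * X i ^ l, ?_, ?_, fun i' hi' ↦ ?_⟩
  · simpa using hP.mul ((isHomogeneous_X F i).pow l)
  · rw [map_mul, map_pow, aeval_X]
    exact mul_ne_zero hP0 (pow_ne_zero _ hi)
  · have h1 : v ω (aeval y (Q * X i ^ k)) ≤ v ω (y i') ^ (k + l) := by
      refine Valuation.aeval_le_pow (h.map_le_one ω) hi' ?_
      simpa [add_comm] using hQ.mul ((isHomogeneous_X F i).pow k)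
    refine lt_of_lt_of_le ?_ h1
    have h2 : aeval y (P * X i ^ l) = (y i)⁻¹ ^ k * aeval y P / ((y i)⁻¹ ^ l * aeval y Q) *
        aeval y (Q * X i ^ k) := by
      simp only [map_mul, map_pow, aeval_X, inv_pow]
      field_simp
    rw [h2, map_mul]
    refine mul_lt_of_lt_one_left (zero_lt_iff.2 ?_) hlt
    rw [Valuation.ne_zero_iff, map_mul, map_pow, aeval_X]
    exact mul_ne_zero hQ0 (pow_ne_zero _ hi)

/-- A form that absorbs poles of size `C ω` at all places of `S`: multiply together high powers of
the forms vanishing at the individual places. The factors do no harm elsewhere, as no form of degree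
`k` exceeds `v ω (y i) ^ k`. -/
theorem exists_form_mul_le (S : Finset Ω) (C : Ω → ℤᵐ⁰) :
    ∃ (k : ℕ) (G : MvPolynomial (Fin m) F), G.IsHomogeneous k ∧ aeval y G ≠ 0 ∧
      ∀ ω ∈ S, ∀ i, (∀ j, v ω (y j) ≤ v ω (y i)) → v ω (aeval y G) * C ω ≤ v ω (y i) ^ k := by
  classical
  induction S using Finset.induction_on with
  | empty => exact ⟨0, 1, isHomogeneous_one _ _, by simp, by simp⟩
  | insert ω S _ ih =>
    obtain ⟨k, G, hG, hG0, hGS⟩ := ih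
    obtain ⟨l, P, hP, hP0, hPω⟩ := h.exists_form_lt ω
    obtain ⟨i₀, hi₀⟩ := h.exists_chart ω
    have hpos : 0 < v ω (y i₀) ^ l := lt_of_le_of_lt zero_le (hPω i₀ hi₀)
    obtain ⟨N, hN⟩ := exists_pow_mul_le_one
      (t := v ω (aeval y P) / v ω (y i₀) ^ l) ((div_lt_one₀ hpos).2 (hPω i₀ hi₀)) (C ω)
    refine ⟨k + l * N, G * P ^ N, hG.mul (hP.pow N), ?_, fun ω' hω' i hi ↦ ?_⟩
    · rw [map_mul, map_pow]
      exact mul_ne_zero hG0 (pow_ne_zero _ hP0)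
    · rw [map_mul, map_pow, map_mul, map_pow, pow_add, pow_mul]
      rcases Finset.mem_insert.1 hω' with rfl | hω'
      · have hii : v ω' (y i) = v ω' (y i₀) := le_antisymm (hi₀ i) (hi i₀)
        rw [mul_assoc]
        refine mul_le_mul' (Valuation.aeval_le_pow (h.map_le_one ω') hi hG) ?_
        rw [hii]
        rw [div_pow, div_mul_eq_mul_div, div_le_one₀ (pow_pos hpos N)] at hN
        exact hN
      · rw [mul_right_comm]
        exact mul_le_mul' (hGS ω' hω' i hi)
          (pow_le_pow_left' (Valuation.aeval_le_pow (h.map_le_one ω') hi hP) N)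

/-- Each finite set of places misses some place, if there are places at all. -/
theorem exists_notMem_finset [Nonempty Ω] (S : Finset Ω) : ∃ ω, ω ∉ S := by
  by_contra! hS
  obtain ⟨ω₀⟩ := ‹Nonempty Ω›
  obtain ⟨i, hi⟩ := h.exists_chart ω₀
  obtain ⟨k, G, hG, hG0, hGS⟩ := h.exists_form_mul_le S fun _ ↦ exp 1
  have hyi := h.indep.ne_zero i
  -- If `S` contained every place, `u` would vanish at all places centred over the chart `i`. Then
  -- `1 + u` is a unit of a polynomial ring, so `u` is a nonzero constant, contradicting `v ω₀ u <
  -- 1`.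
  set u := (y i)⁻¹ ^ k * aeval y G with hu
  have hlt : ∀ ω, (∀ j, v ω (y j) ≤ v ω (y i)) → v ω u < 1 := fun ω hω ↦ by
    have hpos : 0 < v ω (y i) ^ k := zero_lt_iff.2 (pow_ne_zero _ (by simpa using hyi))
    rw [hu, map_mul, map_pow, map_inv₀, inv_pow, inv_mul_lt_one₀ hpos]
    have hG : v ω (aeval y G) ≠ 0 := by simpa using hG0
    refine lt_of_lt_of_le ?_ (hGS ω (hS ω) i hω)
    exact lt_mul_of_one_lt_right (zero_lt_iff.2 hG) (by rw [← exp_zero, exp_lt_exp]; exact one_pos)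
  have hu0 : u ≠ 0 := mul_ne_zero (pow_ne_zero _ (inv_ne_zero hyi)) hG0
  set R := Algebra.adjoin F (Set.range fun j ↦ (y i)⁻¹ * y j)
  have huR : u ∈ R := by
    rw [hu, ← aeval_mul_left_of_isHomogeneous hG]
    rw [show R = _ from Algebra.adjoin_range_eq_range_aeval F fun j ↦ (y i)⁻¹ * y j]
    exact ⟨G, rfl⟩
  have h1u : (1 + u) ≠ 0 := fun h0 ↦ by
    have h1 := hlt ω₀ hi
    rw [eq_neg_of_add_eq_zero_right h0, Valuation.map_neg, map_one] at h1
    exact lt_irrefl _ h1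
  have hinv : IsIntegral R (1 + u)⁻¹ := h.isIntegral i _ fun ω hω ↦ by
    rw [map_inv₀, Valuation.map_one_add_of_lt _ (hlt ω hω), inv_one]
  -- Invertibility descends along the integral extension from `R` to its integral closure.
  have hunit : IsUnit (⟨1 + u, add_mem (one_mem _) huR⟩ : R) := by
    have hloc : IsLocalHom (algebraMap R (integralClosure R K)) :=
      RingHom.IsIntegral.isLocalHom (algebraMap_isIntegral_iff.2 inferInstance)
        fun x y hxy ↦ Subtype.ext (congrArg (algebraMap (integralClosure R K) K) hxy)
    refine hloc.map_nonunit _ (IsUnit.of_mul_eq_one ⟨(1 + u)⁻¹, hinv⟩ (Subtype.ext ?_))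
    exact mul_inv_cancel₀ h1u
  obtain ⟨a, ha⟩ := h.indep.exists_eq_algebraMap_of_isUnit i hunit
  have hua : u = algebraMap F K (a - 1) := by
    rw [map_sub, map_one]
    linear_combination ha
  have h1 := hlt ω₀ hi
  rw [hua] at hu0 h1
  exact h1.ne (Valuation.eq_one_of_ne_zero (h.map_le_one ω₀) fun h0 ↦ hu0 (by rw [h0, map_zero]))

/-- A function with bounded poles that vanishes to a high order at some place is zero. -/
theorem exists_forall_eq_zero (ω₀ : Ω) (S : Finset Ω) (C : Ω → ℤᵐ⁰) :
    ∃ N : ℕ, ∀ b : K, (∀ ω ∉ S, v ω b ≤ 1) → (∀ ω ∈ S, v ω b ≤ C ω) →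
      v ω₀ b ≤ exp (-(N : ℤ)) → b = 0 := by
  obtain ⟨i, hi⟩ := h.exists_chart ω₀
  obtain ⟨j, hji⟩ := h.exists_ne ω₀ i
  obtain ⟨k, G, hG, hG0, hGS⟩ := h.exists_form_mul_le S C
  have := h.finite
  have hint := h.indep.isIntegrallyClosed_adjoin
  have hy := h.indep.ne_zero
  set r := Module.finrank (ratioField F y) K with hr
  let φ : MvPolynomial (Fin m) F →ₗ[F] K :=
    LinearMap.mulLeft F ((y i)⁻¹ ^ (k * r)) ∘ₗ (aeval y).toLinearMap
  have hfin : FiniteDimensional F ((homogeneousSubmodule (Fin m) F (k * r)).map φ) :=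
    Module.Finite.iff_fg.2 (Submodule.FG.map φ (homogeneousSubmodule_fg (Fin m) F (k * r)))
  obtain ⟨N, hN⟩ := Valuation.exists_forall_mem_eq_zero (h.map_le_one ω₀)
    ((homogeneousSubmodule (Fin m) F (k * r)).map φ)
  refine ⟨N, fun b hbS hbC hb0 ↦ ?_⟩
  have hval : ∀ l ω, (∀ j, v ω (y j) ≤ v ω (y l)) →
      v ω ((y l)⁻¹ ^ k * aeval y G * b) ≤ 1 := fun l ω hω ↦ by
    have hpos : 0 < v ω (y l) ^ k := zero_lt_iff.2 (pow_ne_zero _ (by simpa using hy l))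
    rw [mul_assoc, map_mul, map_pow, map_inv₀, inv_pow, inv_mul_le_one₀ hpos, map_mul]
    by_cases hωS : ω ∈ S
    · exact (mul_le_mul_right (hbC ω hωS) _).trans (hGS ω hωS l hω)
    · exact (mul_le_mul' (Valuation.aeval_le_pow (h.map_le_one ω) hω hG) (hbS ω hωS)).trans_eq
        (mul_one _)
  have hnorm := fun l ↦ exists_norm_eq_mul (ratioField_eq l (hy l)) (h.isIntegral l _ (hval l))
  set c := (y i)⁻¹ ^ k * aeval y G * b with hc
  -- Passing to the chart `j` multiplies `c` by an element of the ratio field, so its norm is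
  -- multiplied by the `r`-th power of that element; this gives the pole bound `k * r`.
  have hcj : (y j)⁻¹ ^ k * aeval y G * b = algebraMap (ratioField F y) K
      (⟨(y j)⁻¹ * y i, IntermediateField.subset_adjoin _ _ ⟨(j, i), rfl⟩⟩ ^ k) * c := by
    have hyi := hy i
    rw [map_pow, hc]
    change _ = ((y j)⁻¹ * y i) ^ k * _
    rw [mul_pow, inv_pow (y i)]
    field_simp
  obtain ⟨hci, d, hd, hcd⟩ := hnorm i
  have hcj' := (hnorm j).1
  rw [hcj, map_mul, Algebra.norm_algebraMap, ← hr, ← pow_mul, mul_comm] at hcj'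
  obtain ⟨P, hP, hPc⟩ := h.indep.exists_eq_of_mem_adjoin_of_mem_adjoin hji.symm hci hcj'
  have hle : ∀ {z}, IsIntegral (Algebra.adjoin F (Set.range fun j ↦ (y i)⁻¹ * y j)) z →
      v ω₀ z ≤ 1 := fun hz ↦ by
    refine Valuation.le_one_of_isIntegral (fun a ↦ ?_) hz
    refine Valuation.le_one_of_mem_adjoin (h.map_le_one ω₀) ?_ a.2
    rintro _ ⟨l, rfl⟩
    rw [map_mul, map_inv₀, inv_mul_le_one₀ (zero_lt_iff.2 (by simpa using hy i))]
    exact hi l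
  have hG1 : v ω₀ ((y i)⁻¹ ^ k * aeval y G) ≤ 1 := by
    have hpos : 0 < v ω₀ (y i) ^ k := zero_lt_iff.2 (pow_ne_zero _ (by simpa using hy i))
    rw [map_mul, map_pow, map_inv₀, inv_pow, inv_mul_le_one₀ hpos]
    exact Valuation.aeval_le_pow (h.map_le_one ω₀) hi hG
  have h0 : (Algebra.norm (ratioField F y) c : K) = 0 := by
    refine hN _ ⟨P, hP, hPc.symm⟩ ?_
    rw [hcd, map_mul, map_mul]
    calc _ ≤ 1 * v ω₀ b * 1 := mul_le_mul' (mul_le_mul_left hG1 _) (hle hd)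
      _ ≤ _ := by rwa [one_mul, mul_one]
  have hc0 : c = 0 := Algebra.norm_eq_zero_iff.1 (Subtype.ext h0 : Algebra.norm (ratioField F y) c = 0)
  exact (mul_eq_zero.1 hc0).resolve_left (mul_ne_zero (pow_ne_zero _ (inv_ne_zero (hy i))) hG0)

end IsNormalizedModel

end Model

/-! ### Regularity in codimension one on normal noetherian domains -/

section Hartogs

variable {R K : Type*} [CommRing R] [IsDomain R] [IsNoetherianRing R] [IsIntegrallyClosed R]
  [Field K] [Algebra R K] [IsFractionRing R K]

/-- In a normal noetherian domain, a proper ideal of the form `(R : z)` that is prime has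
height one. -/
theorem height_eq_one_of_forall_mem_iff {p : Ideal R} [hp : p.IsPrime] {z : K}
    (hz : ∀ r : R, r ∈ p ↔ ∃ a : R, algebraMap R K r * z = algebraMap R K a) :
    p.height = 1 := by
  have hinj := IsFractionRing.injective R K
  have hzR : ∀ a : R, z ≠ algebraMap R K a := fun a ha ↦
    hp.ne_top ((Ideal.eq_top_iff_one p).2 ((hz 1).2 ⟨a, by rw [map_one, one_mul, ha]⟩))
  have hbot : p ≠ ⊥ := by
    obtain ⟨a, s, hs, rfl⟩ := IsFractionRing.div_surjective (A := R) z
    have hs0 := nonZeroDivisors.ne_zero hs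
    refine Submodule.ne_bot_iff _ |>.2 ⟨s, (hz s).2 ⟨a, mul_div_cancel₀ _ ?_⟩, hs0⟩
    simpa using hs0
  -- If instead `z` mapped `p` into itself, `z` would be integral over `R` because `p` is finitely
  -- generated, hence in `R`.
  obtain ⟨t, ht, u, hu, htu⟩ : ∃ t ∈ p, ∃ u ∉ p, algebraMap R K t * z = algebraMap R K u := by
    by_contra! hc
    have hint : IsIntegral R z := by
      refine isIntegral_of_smul_mem_submodule (Submodule.map (Algebra.linearMap R K) p) ?_
        (Submodule.FG.map _ (IsNoetherian.noetherian p)) z ?_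
      · obtain ⟨r, hr, hr0⟩ := (Submodule.ne_bot_iff p).1 hbot
        exact (Submodule.ne_bot_iff _).2 ⟨_, ⟨r, hr, rfl⟩, (map_ne_zero_iff _ hinj).2 hr0⟩
      · rintro _ ⟨t, ht, rfl⟩
        obtain ⟨u, hu⟩ := (hz t).1 ht
        refine ⟨u, by_contra fun h ↦ hc t ht u h hu, ?_⟩
        rw [Algebra.linearMap_apply, Algebra.linearMap_apply, smul_eq_mul, ← hu, mul_comm]
    obtain ⟨a, ha⟩ := IsIntegrallyClosed.isIntegral_iff.1 hint
    exact hzR a ha.symm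
  have hmin : p ∈ (Ideal.span {t}).minimalPrimes := by
    refine ⟨⟨hp, (Ideal.span_singleton_le_iff_mem p).2 ht⟩, fun q ⟨hq, htq⟩ hqp r hr ↦ ?_⟩
    obtain ⟨a, ha⟩ := (hz r).1 hr
    have hru : r * u = a * t := hinj (by
      rw [map_mul, map_mul, ← ha, ← htu]; ring)
    have : r * u ∈ q := hru ▸ Ideal.mul_mem_left _ _ ((Ideal.span_singleton_le_iff_mem q).1 htq)
    exact (hq.mem_or_mem this).resolve_right fun h ↦ hu (hqp h)
  refine le_antisymm (Ideal.height_le_one_of_isPrincipal_of_mem_minimalPrimes _ _ hmin) ?_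
  rw [Order.one_le_iff_ne_zero, Ne, Ideal.height_eq_zero_iff_eq_bot]
  exact hbot

/-- An element of the fraction field of a normal noetherian domain that is regular at all primes
of height one is regular. -/
theorem exists_eq_algebraMap_of_height_eq_one {b : K}
    (hb : ∀ p : Ideal R, p.IsPrime → p.height = 1 →
      ∃ s ∉ p, ∃ a, algebraMap R K s * b = algebraMap R K a) :
    ∃ a : R, algebraMap R K a = b := by
  -- In `K / R` the annihilator of the class of `b` is its ideal of denominators. If `b ∉ R`, this
  -- ideal lies in an associated prime, which has height one, contradicting `hb`.
  let M := K ⧸ LinearMap.range (Algebra.linearMap R K)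
  by_contra hbR
  have hb0 : (Submodule.Quotient.mk b : M) ≠ 0 := fun h ↦
    hbR ((Submodule.Quotient.mk_eq_zero _).1 h)
  obtain ⟨p, hp, hle⟩ := exists_le_isAssociatedPrime_of_isNoetherianRing R _ hb0
  obtain ⟨hp, w, hw⟩ := isAssociatedPrime_iff.1 hp
  obtain ⟨z, rfl⟩ := Submodule.Quotient.mk_surjective _ w
  have key : ∀ (z : K) (r : R), r • (Submodule.Quotient.mk z : M) = 0 ↔
      ∃ a : R, algebraMap R K r * z = algebraMap R K a := fun z r ↦ by
    rw [← Submodule.Quotient.mk_smul, Submodule.Quotient.mk_eq_zero, Algebra.smul_def]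
    exact exists_congr fun a ↦ eq_comm
  have hz : ∀ r : R, r ∈ p ↔ ∃ a : R, algebraMap R K r * z = algebraMap R K a := fun r ↦ by
    rw [← key, hw]
    simp
  obtain ⟨s, hs, a, ha⟩ := hb p hp (height_eq_one_of_forall_mem_iff hz)
  refine hs (hle ?_)
  have := (key b s).2 ⟨a, ha⟩
  simpa using this

end Hartogs

/-! ### Quotients of forms -/

section HomogeneousLocalization

open MvPolynomial

attribute [local instance] MvPolynomial.gradedAlgebra

namespace MvPolynomial

variable {F : Type u} [Field F] {n : ℕ}

/-- A quotient of two forms of the same degree, regular at a homogeneous prime. -/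
noncomputable def formQuotient {S : Submonoid (MvPolynomial (Fin (n + 1)) F)} {k : ℕ}
    {P Q : MvPolynomial (Fin (n + 1)) F} (hP : P.IsHomogeneous k) (hQ : Q.IsHomogeneous k)
    (h : Q ∈ S) : HomogeneousLocalization (homogeneousSubmodule (Fin (n + 1)) F) S :=
  .mk ⟨k, ⟨P, hP⟩, ⟨Q, hQ⟩, h⟩

theorem val_formQuotient_mul {S : Submonoid (MvPolynomial (Fin (n + 1)) F)} {k : ℕ}
    {P Q : MvPolynomial (Fin (n + 1)) F} (hP : P.IsHomogeneous k) (hQ : Q.IsHomogeneous k)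
    (h : Q ∈ S) :
    (formQuotient hP hQ h).val * algebraMap (MvPolynomial (Fin (n + 1)) F) (Localization S) Q = algebraMap _ _ P := by
  rw [formQuotient, HomogeneousLocalization.val_mk, Localization.mk_eq_mk']
  exact IsLocalization.mk'_spec (Localization S) P ⟨Q, h⟩

/-- The constants in a homogeneous localization. -/
noncomputable def constHom (F : Type u) [Field F] (n : ℕ)
    (S : Submonoid (MvPolynomial (Fin (n + 1)) F)) :
    F →+* HomogeneousLocalization (homogeneousSubmodule (Fin (n + 1)) F) S :=
  (HomogeneousLocalization.fromZeroRingHom (homogeneousSubmodule (Fin (n + 1)) F) S).comp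
    (algebraMap F (homogeneousSubmodule (Fin (n + 1)) F 0))

theorem val_constHom (S : Submonoid (MvPolynomial (Fin (n + 1)) F)) (a : F) :
    (constHom F n S a).val = algebraMap (MvPolynomial (Fin (n + 1)) F) (Localization S) (C a) := by
  change (HomogeneousLocalization.mk _).val = _
  rw [HomogeneousLocalization.val_mk, Localization.mk_eq_mk']
  exact IsLocalization.mk'_one (M := S) (Localization S) (C a)

variable {S : Submonoid (MvPolynomial (Fin (n + 1)) F)} {i : Fin (n + 1)} (hi : X i ∈ S)

theorem val_eval₂_constHom_mul {k : ℕ} {P : MvPolynomial (Fin (n + 1)) F}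
    (hP : P.IsHomogeneous k) :
    (eval₂ (constHom F n S)
      (fun j ↦ formQuotient (isHomogeneous_X F j) (isHomogeneous_X F i) hi) P).val *
        algebraMap (MvPolynomial (Fin (n + 1)) F) (Localization S) (X i ^ k) = algebraMap _ _ P := by
  let val : HomogeneousLocalization (homogeneousSubmodule (Fin (n + 1)) F) S →+* Localization S :=
    algebraMap _ _
  let _ : Algebra F (Localization S) := ((algebraMap (MvPolynomial (Fin (n + 1)) F) (Localization S)).comp C).toAlgebra
  change val (eval₂ _ _ P) * _ = _
  have h1 : val.comp (constHom F n S) = algebraMap F (Localization S) :=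
    RingHom.ext fun a ↦ val_constHom S a
  rw [hom_eval₂, h1, ← aeval_def, map_pow, mul_comm, ← aeval_mul_left_of_isHomogeneous hP]
  have h2 : ∀ j, algebraMap (MvPolynomial (Fin (n + 1)) F) (Localization S) (X i) *
      val (formQuotient (isHomogeneous_X F j) (isHomogeneous_X F i) hi) =
        algebraMap (MvPolynomial (Fin (n + 1)) F) (Localization S) (X j : MvPolynomial (Fin (n + 1)) F) := fun j ↦ by
    rw [mul_comm]
    exact val_formQuotient_mul (isHomogeneous_X F j) (isHomogeneous_X F i) hi
  simp only [h2]
  rw [aeval_def]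
  conv_rhs => rw [← eval₂_eta P]
  rw [hom_eval₂]
  rfl

theorem formQuotient_mul_eval₂ {k : ℕ} {P Q : MvPolynomial (Fin (n + 1)) F}
    (hP : P.IsHomogeneous k) (hQ : Q.IsHomogeneous k) (h : Q ∈ S) :
    formQuotient hP hQ h * eval₂ (constHom F n S)
      (fun j ↦ formQuotient (isHomogeneous_X F j) (isHomogeneous_X F i) hi) Q =
    eval₂ (constHom F n S)
      (fun j ↦ formQuotient (isHomogeneous_X F j) (isHomogeneous_X F i) hi) P := by
  apply HomogeneousLocalization.val_injective
  have hu : IsUnit (algebraMap (MvPolynomial (Fin (n + 1)) F) (Localization S) (X i ^ k : MvPolynomial (Fin (n + 1)) F)) :=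
    IsLocalization.map_units (Localization S) (⟨_, pow_mem hi k⟩ : S)
  apply hu.mul_right_cancel
  rw [HomogeneousLocalization.val_mul, mul_assoc, val_eval₂_constHom_mul hi hQ,
    val_eval₂_constHom_mul hi hP, val_formQuotient_mul]

/-- After multiplication by the unit `X i ^ k`, the dehomogenized form becomes `P` in the
localization at `p`. -/
theorem isUnit_eval₂_iff {p : Ideal (MvPolynomial (Fin (n + 1)) F)} [p.IsPrime]
    {i : Fin (n + 1)} (hi : X i ∈ p.primeCompl) {k : ℕ} {P : MvPolynomial (Fin (n + 1)) F}
    (hP : P.IsHomogeneous k) :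
    IsUnit (eval₂ (constHom F n p.primeCompl)
      (fun j ↦ formQuotient (isHomogeneous_X F j) (isHomogeneous_X F i) hi) P) ↔ P ∉ p := by
  have hu : IsUnit (algebraMap _ (Localization p.primeCompl)
      (X i ^ k : MvPolynomial (Fin (n + 1)) F)) :=
    IsLocalization.map_units _ (⟨_, pow_mem hi k⟩ : p.primeCompl)
  rw [← HomogeneousLocalization.isUnit_iff_isUnit_val, ← and_iff_left (a := IsUnit _) hu,
    ← IsUnit.mul_iff, val_eval₂_constHom_mul hi hP]
  exact IsLocalization.AtPrime.isUnit_to_map_iff (Localization.AtPrime p) p P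

end MvPolynomial

end HomogeneousLocalization

/-! ### Standard charts of a scheme over projective space -/

section Charts

open MvPolynomial

attribute [local instance] MvPolynomial.gradedAlgebra

namespace AlgebraicGeometry.Scheme

variable {F : Type u} [Field F] {n : ℕ} {Z : Scheme.{u}}
  (f : Z ⟶ Proj (homogeneousSubmodule (Fin (n + 1)) F))

instance isPrime_toIdeal (x : Proj (homogeneousSubmodule (Fin (n + 1)) F)) :
    x.asHomogeneousIdeal.toIdeal.IsPrime :=
  x.isPrime

/-- The map from the homogeneous localization at the image of `x` to the local ring at `x`. -/
noncomputable def homogeneousStalkHom (x : Z) :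
    HomogeneousLocalization.AtPrime (homogeneousSubmodule (Fin (n + 1)) F)
      (f x).asHomogeneousIdeal.toIdeal →+* Z.presheaf.stalk x :=
  ((Proj.stalkIso (homogeneousSubmodule (Fin (n + 1)) F) (f x)).inv ≫ f.stalkMap x).hom

instance (x : Z) : IsLocalHom (homogeneousStalkHom f x) := by
  have h1 : IsLocalHom (Proj.stalkIso (homogeneousSubmodule (Fin (n + 1)) F) (f x)).inv.hom :=
    isLocalHom_of_isIso _
  exact RingHom.isLocalHom_comp (f.stalkMap x).hom _

/-- The sections over the preimage of a standard open set that come from projective space. -/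
noncomputable def awayToPreimage (Q : MvPolynomial (Fin (n + 1)) F) :
    HomogeneousLocalization.Away (homogeneousSubmodule (Fin (n + 1)) F) Q →+*
      Γ(Z, f ⁻¹ᵁ Proj.basicOpen _ Q) :=
  (Proj.awayToSection _ Q ≫ f.app (Proj.basicOpen _ Q)).hom

theorem germ_awayToPreimage (Q : MvPolynomial (Fin (n + 1)) F) (x : Z)
    (hx : x ∈ f ⁻¹ᵁ Proj.basicOpen _ Q)
    (z : HomogeneousLocalization.Away (homogeneousSubmodule (Fin (n + 1)) F) Q) :
    Z.presheaf.germ _ x hx (awayToPreimage f Q z) =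
      homogeneousStalkHom f x
        (HomogeneousLocalization.mapId _ (Submonoid.powers_le.mpr hx) z) := by
  have h1 := ProjectiveSpectrum.Proj.awayToSection_germ
    (homogeneousSubmodule (Fin (n + 1)) F) Q (f x) hx
  have h2 := Hom.germ_stalkMap f (Proj.basicOpen _ Q) x hx
  have h3 : (Proj.awayToSection _ Q ≫ f.app (Proj.basicOpen _ Q)) ≫ Z.presheaf.germ _ x hx =
      CommRingCat.ofHom (HomogeneousLocalization.mapId _ (Submonoid.powers_le.mpr hx)) ≫
        (Proj.stalkIso (homogeneousSubmodule (Fin (n + 1)) F) (f x)).inv ≫ f.stalkMap x := by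
    rw [Category.assoc, ← h2]
    exact congrArg (· ≫ f.stalkMap x) h1
  exact congrArg (fun g ↦ g.hom z) h3

/-- The standard open set is affine, and a closed immersion is surjective on sections over affine
open sets. -/
theorem awayToPreimage_surjective [IsClosedImmersion f] {Q : MvPolynomial (Fin (n + 1)) F} {d : ℕ}
    (hQ : Q.IsHomogeneous d) (hd : 0 < d) : Function.Surjective (awayToPreimage f Q) := by
  have h1 : Function.Bijective (Proj.awayToSection (homogeneousSubmodule (Fin (n + 1)) F) Q) :=
    ConcreteCategory.bijective_of_isIso
      (Proj.basicOpenIsoAway (homogeneousSubmodule (Fin (n + 1)) F) Q hQ hd).hom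
  have h2 := f.app_surjective _ (Proj.isAffineOpen_basicOpen
    (homogeneousSubmodule (Fin (n + 1)) F) Q hQ hd)
  exact h2.comp h1.2

/-- A homogeneous prime containing all variables would contain the irrelevant ideal. -/
theorem exists_X_notMem (x : Z) : ∃ i, (X i : MvPolynomial (Fin (n + 1)) F) ∉
    (f x).asHomogeneousIdeal.toIdeal := by
  by_contra! hc
  refine (f x).not_irrelevant_le ((HomogeneousIdeal.toIdeal_irrelevant_le _).2 ?_)
  intro k hk P hP
  change P ∈ (f x).asHomogeneousIdeal.toIdeal
  rw [P.as_sum]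
  refine Ideal.sum_mem _ fun d hd ↦ ?_
  have hdk := IsHomogeneous.degree_eq_sum_deg_support (φ := P) hP hd
  obtain ⟨i, hi⟩ : ∃ i, d i ≠ 0 := by
    by_contra! h0
    rw [Finset.sum_eq_zero fun i _ ↦ h0 i] at hdk
    omega
  exact Ideal.mem_of_dvd _ (X_dvd_monomial.2 (Or.inr hi)) (hc i)

end AlgebraicGeometry.Scheme

end Charts

/-! ### Homogeneous coordinates of the generic point -/

section Coordinates

open MvPolynomial

attribute [local instance] MvPolynomial.gradedAlgebra

namespace AlgebraicGeometry.Scheme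

variable {F : Type u} [Field F] {n : ℕ} {Z : Scheme.{u}} [IsIntegral Z]
  (f : Z ⟶ Proj (homogeneousSubmodule (Fin (n + 1)) F))
  {i : Fin (n + 1)}
  (hi : (X i : MvPolynomial (Fin (n + 1)) F) ∈
    (f (genericPoint Z)).asHomogeneousIdeal.toIdeal.primeCompl)

/-- The homogeneous coordinates of the generic point, normalized by the coordinate `i`. -/
noncomputable def genericCoordinate (j : Fin (n + 1)) : Z.functionField :=
  homogeneousStalkHom f (genericPoint Z)
    (formQuotient (isHomogeneous_X F j) (isHomogeneous_X F i) hi)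

variable [Algebra F Z.functionField]
  (hF : algebraMap F Z.functionField =
    (homogeneousStalkHom f (genericPoint Z)).comp (constHom F n _))

include hF

theorem aeval_genericCoordinate (P : MvPolynomial (Fin (n + 1)) F) :
    aeval (genericCoordinate f hi) P = homogeneousStalkHom f (genericPoint Z)
      (eval₂ (constHom F n _)
        (fun j ↦ formQuotient (isHomogeneous_X F j) (isHomogeneous_X F i) hi) P) := by
  rw [hom_eval₂, aeval_def, hF]
  rfl

/-- The map to the function field is local, so a nonzero value means a unit in the homogeneous
localization. -/
theorem aeval_genericCoordinate_ne_zero_iff {k : ℕ} {P : MvPolynomial (Fin (n + 1)) F}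
    (hP : P.IsHomogeneous k) : aeval (genericCoordinate f hi) P ≠ 0 ↔
      P ∈ (f (genericPoint Z)).asHomogeneousIdeal.toIdeal.primeCompl := by
  rw [aeval_genericCoordinate f hi hF, ← isUnit_iff_ne_zero]
  exact (isUnit_map_iff (homogeneousStalkHom f (genericPoint Z)) _).trans
    (isUnit_eval₂_iff hi hP)

theorem homogeneousStalkHom_formQuotient {k : ℕ} {P Q : MvPolynomial (Fin (n + 1)) F}
    (hP : P.IsHomogeneous k) (hQ : Q.IsHomogeneous k)
    (h : Q ∈ (f (genericPoint Z)).asHomogeneousIdeal.toIdeal.primeCompl) :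
    homogeneousStalkHom f (genericPoint Z) (formQuotient hP hQ h) =
      (aeval (genericCoordinate f hi) Q)⁻¹ * aeval (genericCoordinate f hi) P := by
  have h0 := (aeval_genericCoordinate_ne_zero_iff f hi hF hQ).2 h
  rw [eq_inv_mul_iff_mul_eq₀ h0, mul_comm, aeval_genericCoordinate f hi hF,
    aeval_genericCoordinate f hi hF, ← map_mul, formQuotient_mul_eval₂ hi]

omit hF in
theorem genericPoint_mem {U : Z.Opens} (hU : Nonempty U) : genericPoint Z ∈ U :=
  ((genericPoint_spec Z).mem_open_set_iff U.isOpen).mpr (by simpa using hU)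

omit hF [Algebra F Z.functionField] in
theorem nonempty_preimage_basicOpen {L : MvPolynomial (Fin (n + 1)) F}
    (h : L ∈ (f (genericPoint Z)).asHomogeneousIdeal.toIdeal.primeCompl) :
    Nonempty (f ⁻¹ᵁ Proj.basicOpen _ L) :=
  ⟨⟨genericPoint Z, h⟩⟩

variable {L : MvPolynomial (Fin (n + 1)) F} (hL : L.IsHomogeneous 1)
  [hne : Nonempty (f ⁻¹ᵁ Proj.basicOpen _ L)]

/-- A quotient of forms whose denominator is a power of a linear form is regular where the linear
form does not vanish. -/
theorem germToFunctionField_awayToPreimage_formQuotient {k : ℕ}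
    {P : MvPolynomial (Fin (n + 1)) F} (hP : P.IsHomogeneous k) {m : ℕ}
    (hLm : (L ^ m).IsHomogeneous k) :
    Z.germToFunctionField (f ⁻¹ᵁ Proj.basicOpen _ L)
      (awayToPreimage f L (formQuotient hP hLm ⟨m, rfl⟩)) =
        (aeval (genericCoordinate f hi) L)⁻¹ ^ m * aeval (genericCoordinate f hi) P := by
  refine (germ_awayToPreimage f L (genericPoint Z) (genericPoint_mem hne) _).trans ?_
  have h := homogeneousStalkHom_formQuotient f hi hF hP hLm
    (pow_mem (S := (f (genericPoint Z)).asHomogeneousIdeal.toIdeal.primeCompl)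
      (genericPoint_mem hne) m)
  rw [map_pow, ← inv_pow] at h
  exact h

include hL in
theorem germToFunctionField_mem_adjoin [IsClosedImmersion f]
    (t : Γ(Z, f ⁻¹ᵁ Proj.basicOpen _ L)) :
    Z.germToFunctionField (f ⁻¹ᵁ Proj.basicOpen _ L) t ∈ Algebra.adjoin F
      (Set.range fun j ↦ (aeval (genericCoordinate f hi) L)⁻¹ * genericCoordinate f hi j) := by
  obtain ⟨z, rfl⟩ := awayToPreimage_surjective f hL one_pos t
  obtain ⟨m, P, hP, rfl⟩ := HomogeneousLocalization.Away.mk_surjective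
    (homogeneousSubmodule (Fin (n + 1)) F) hL z
  have hP : P.IsHomogeneous (m • 1) := hP
  have hLm : (L ^ m).IsHomogeneous (m • 1) := by simpa using hL.pow m
  have h := germToFunctionField_awayToPreimage_formQuotient f hi hF hP hLm
  have h2 := aeval_mul_left_of_isHomogeneous hP (aeval (genericCoordinate f hi) L)⁻¹
    (genericCoordinate f hi)
  rw [smul_eq_mul, mul_one] at h2
  refine Eq.subst (motive := (· ∈ _)) (h2.trans h.symm) ?_
  rw [Algebra.adjoin_range_eq_range_aeval]
  exact ⟨P, rfl⟩

include hL in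
theorem exists_germToFunctionField_eq (j : Fin (n + 1)) :
    ∃ t, Z.germToFunctionField (f ⁻¹ᵁ Proj.basicOpen _ L) t =
      (aeval (genericCoordinate f hi) L)⁻¹ * genericCoordinate f hi j := by
  have h := germToFunctionField_awayToPreimage_formQuotient f hi hF (isHomogeneous_X F j)
    (m := 1) (by simpa using hL)
  exact ⟨_, h.trans (by rw [pow_one, aeval_X])⟩

include hi in
theorem exists_germToFunctionField_eq_algebraMap (a : F) :
    ∃ t, Z.germToFunctionField (f ⁻¹ᵁ Proj.basicOpen _ L) t = algebraMap F _ a := by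
  have h := germToFunctionField_awayToPreimage_formQuotient f hi hF (isHomogeneous_C _ a)
    (L := L) (m := 0) (by simpa using isHomogeneous_one _ _)
  exact ⟨_, h.trans (by rw [pow_zero, one_mul, aeval_C])⟩

end AlgebraicGeometry.Scheme

end Coordinates

/-! ### Rational functions on affine open sets -/

section Affine

open AlgebraicGeometry.Scheme

/-- The sections of a scheme over an affine open set form a normal ring if the local rings are
normal. -/
theorem isIntegrallyClosed_of_isAffineOpen {Z : Scheme.{u}} [IsIntegral Z] {W : Z.Opens}
    (hW : IsAffineOpen W) [Nonempty W]
    (hZ : ∀ x : Z, IsIntegrallyClosed (Z.presheaf.stalk x)) : IsIntegrallyClosed Γ(Z, W) := by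
  refine IsIntegrallyClosed.of_localization_maximal fun p _ hp ↦ ?_
  let y : PrimeSpectrum Γ(Z, W) := ⟨p, hp.isPrime⟩
  have hy : hW.fromSpec y ∈ W := (hW.isoSpec.inv y).2
  let _ := TopCat.Presheaf.algebra_section_stalk Z.presheaf (⟨_, hy⟩ : W)
  have : IsLocalization.AtPrime (Z.presheaf.stalk (hW.fromSpec y)) p :=
    hW.isLocalization_stalk' y hy
  have := hZ (hW.fromSpec y)
  exact IsIntegrallyClosed.of_equiv
    (IsLocalization.algEquiv p.primeCompl (Z.presheaf.stalk (hW.fromSpec y))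
      (Localization.AtPrime p)).toRingEquiv

/-- On a normal scheme, a rational function that is regular at all points of codimension one of an
affine open set is regular on that set. -/
theorem exists_germToFunctionField_eq_of_codimOne {Z : Scheme.{u}} [IsIntegral Z]
    [IsLocallyNoetherian Z] {W : Z.Opens} (hW : IsAffineOpen W) [hne : Nonempty W]
    (hZ : ∀ x : Z, IsIntegrallyClosed (Z.presheaf.stalk x)) {b : Z.functionField}
    (hb : ∀ x ∈ W, Order.coheight x = 1 →
      b ∈ Set.range (algebraMap (Z.presheaf.stalk x) Z.functionField)) :
    ∃ t, Z.germToFunctionField W t = b := by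
  have := isIntegrallyClosed_of_isAffineOpen hW hZ
  have : IsNoetherianRing Γ(Z, W) := IsLocallyNoetherian.component_noetherian ⟨W, hW⟩
  have := functionField_isFractionRing_of_isAffineOpen Z W hW
  refine exists_eq_algebraMap_of_height_eq_one (R := Γ(Z, W)) (K := Z.functionField)
    fun p hp hp1 ↦ ?_
  let y : PrimeSpectrum Γ(Z, W) := ⟨p, hp⟩
  have hy : hW.fromSpec y ∈ W := (hW.isoSpec.inv y).2
  let _ := TopCat.Presheaf.algebra_section_stalk Z.presheaf (⟨_, hy⟩ : W)
  have : IsLocalization.AtPrime (Z.presheaf.stalk (hW.fromSpec y)) p :=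
    hW.isLocalization_stalk' y hy
  -- Both the coheight of the point and the height of `p` are the dimension of the local ring.
  have hco : Order.coheight (hW.fromSpec y) = 1 := by
    have h1 := ringKrullDim_stalk_eq_coheight (hW.fromSpec y)
    rw [IsLocalization.AtPrime.ringKrullDim_eq_height p (Z.presheaf.stalk (hW.fromSpec y)),
      hp1] at h1
    exact_mod_cast h1.symm
  obtain ⟨c, rfl⟩ := hb _ hy hco
  obtain ⟨a, s, rfl⟩ := IsLocalization.exists_mk'_eq p.primeCompl c
  refine ⟨s, s.2, a, ?_⟩
  have htower : IsScalarTower Γ(Z, W) (Z.presheaf.stalk (hW.fromSpec y)) Z.functionField :=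
    functionField_isScalarTower Z W ⟨_, hy⟩
  rw [IsScalarTower.algebraMap_apply _ (Z.presheaf.stalk (hW.fromSpec y)) Z.functionField,
    ← map_mul, mul_comm, IsLocalization.mk'_spec,
    ← IsScalarTower.algebraMap_apply _ (Z.presheaf.stalk (hW.fromSpec y)) Z.functionField]

end Affine

/-! ### The projective model attached to a variety -/

namespace SmoothProjectiveVariety

open MvPolynomial AlgebraicGeometry.Scheme

attribute [local instance] MvPolynomial.gradedAlgebra

variable {F : Type u} [Field F] (V : SmoothProjectiveVariety F)

theorem Place.valuation_germToFunctionField_le_one {V : SmoothProjectiveVariety F} (v : V.Place)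
    {W : V.scheme.Opens} [Nonempty W] (hv : v.1 ∈ W) (t : Γ(V.scheme, W)) :
    v.valuation (V.scheme.germToFunctionField W t) ≤ 1 := by
  rw [← algebraMap_germ_eq_germToFunctionField V.scheme hv]
  exact v.prime.valuation_le_one _

theorem Place.exists_algebraMap_eq_of_valuation_le_one {V : SmoothProjectiveVariety F}
    (v : V.Place) {b : V.FunctionField} (hb : v.valuation b ≤ 1) :
    ∃ a : v.LocalRing, algebraMap v.LocalRing V.FunctionField a = b :=
  IsDiscreteValuationRing.exists_lift_of_le_one hb

/-- The valuations of the places, together with the homogeneous coordinates of the generic point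
of a smooth projective variety, form a projective model of the function field. -/
theorem exists_isProjectiveModel : ∃ (_ : Algebra F V.FunctionField) (n : ℕ)
    (s : Fin n → V.FunctionField),
      IsProjectiveModel F (fun v : V.Place ↦ v.valuation) s := by
  obtain ⟨n, f, hf, -⟩ := V.projective
  change V.scheme ⟶ Proj (homogeneousSubmodule (Fin (n + 1)) F) at f
  have hf : IsClosedImmersion f := hf
  obtain ⟨i, hi⟩ := exists_X_notMem f (genericPoint V.scheme)
  -- The constants act through the projective embedding, which makes evaluation of forms at the
  -- coordinates compatible with the stalk maps.
  let alg : Algebra F V.FunctionField :=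
    ((homogeneousStalkHom f (genericPoint V.scheme)).comp (constHom F n _)).toAlgebra
  have hF : algebraMap F V.FunctionField =
    (homogeneousStalkHom f (genericPoint V.scheme)).comp (constHom F n _) := rfl
  let s := genericCoordinate f hi
  have hspan : ∀ ℓ ∈ Submodule.span F (Set.range s), ∃ L : MvPolynomial (Fin (n + 1)) F,
      L.IsHomogeneous 1 ∧ aeval s L = ℓ := fun ℓ hℓ ↦ by
    obtain ⟨c, rfl⟩ := (Submodule.mem_span_range_iff_exists_fun F).1 hℓ
    refine ⟨∑ j, C (c j) * X j, IsHomogeneous.sum _ _ _ fun j _ ↦ isHomogeneous_C_mul_X _ _, ?_⟩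
    simp [Algebra.smul_def]
  refine ⟨alg, n + 1, s, ?_, ?_, ?_, ?_, ?_⟩
  · intro v a
    obtain ⟨j, hj⟩ := exists_X_notMem f v.1
    have hne : Nonempty (f ⁻¹ᵁ Proj.basicOpen (homogeneousSubmodule (Fin (n + 1)) F) (X j)) :=
      ⟨⟨v.1, hj⟩⟩
    obtain ⟨t, ht⟩ := exists_germToFunctionField_eq_algebraMap f hi hF (L := X j) a
    rw [← ht]
    exact v.valuation_germToFunctionField_le_one hj t
  · intro v
    obtain ⟨π, hπ⟩ := v.prime.valuation_exists_uniformizer V.FunctionField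
    refine ⟨π⁻¹, ?_⟩
    rw [map_inv₀]
    change 1 < (v.prime.valuation V.FunctionField π)⁻¹
    rw [hπ, ← WithZero.exp_neg, neg_neg, ← WithZero.exp_zero, WithZero.exp_lt_exp]
    exact one_pos
  · refine ⟨i, fun h0 ↦ ?_⟩
    refine (aeval_genericCoordinate_ne_zero_iff f hi hF (isHomogeneous_X F i)).2 hi ?_
    rwa [aeval_X]
  · intro ℓ hℓ hℓ0
    obtain ⟨L, hL, rfl⟩ := hspan ℓ hℓ
    have hne := nonempty_preimage_basicOpen f
      ((aeval_genericCoordinate_ne_zero_iff f hi hF hL).1 hℓ0)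
    have haff := (Proj.isAffineOpen_basicOpen
      (homogeneousSubmodule (Fin (n + 1)) F) L hL one_pos).preimage f
    have := functionField_isFractionRing_of_isAffineOpen V.scheme _ haff
    rw [eq_top_iff]
    rintro x -
    obtain ⟨a, b, -, rfl⟩ := IsFractionRing.div_surjective
      (A := Γ(V.scheme, f ⁻¹ᵁ Proj.basicOpen (homogeneousSubmodule (Fin (n + 1)) F) L)) x
    exact div_mem
      (IntermediateField.algebra_adjoin_le_adjoin _ _ (germToFunctionField_mem_adjoin f hi hF hL a))
      (IntermediateField.algebra_adjoin_le_adjoin _ _ (germToFunctionField_mem_adjoin f hi hF hL b))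
  · intro ℓ hℓ hℓ0 b hb
    obtain ⟨L, hL, rfl⟩ := hspan ℓ hℓ
    have hne := nonempty_preimage_basicOpen f
      ((aeval_genericCoordinate_ne_zero_iff f hi hF hL).1 hℓ0)
    have haff := (Proj.isAffineOpen_basicOpen
      (homogeneousSubmodule (Fin (n + 1)) F) L hL one_pos).preimage f
    -- A codimension-one point `x` of the chart is a place at which all `s j / ℓ` are regular, so
    -- the hypothesis on `b` applies there.
    obtain ⟨t, rfl⟩ := exists_germToFunctionField_eq_of_codimOne haff
      (stalk_isIntegrallyClosed V.hom) (b := b) fun x hx hx1 ↦ by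
        let v : V.Place := ⟨x, hx1⟩
        refine v.exists_algebraMap_eq_of_valuation_le_one (hb v fun j ↦ ?_)
        obtain ⟨t, ht⟩ := exists_germToFunctionField_eq f hi hF hL j
        have h1 := v.valuation_germToFunctionField_le_one hx t
        rw [ht, map_mul, map_inv₀, inv_mul_le_one₀ (zero_lt_iff.2 (by simpa using hℓ0))] at h1
        exact h1
    exact germToFunctionField_mem_adjoin f hi hF hL t

/-! ### Approximation in the adeles -/

theorem Place.isOpen_ball {V : SmoothProjectiveVariety F} (v : V.Place) (c : v.Completion)
    (γ : WithZero (Multiplicative ℤ)) : IsOpen {z : v.Completion | Valued.v (z - c) < γ} := by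
  obtain ⟨a, rfl⟩ :=
    IsDedekindDomain.HeightOneSpectrum.valuedAdicCompletion_surjective V.FunctionField v.prime γ
  have h := (Valued.isOpen_ball v.Completion (Valued.v.restrict a)).preimage
    (continuous_sub_right c)
  simpa only [Valuation.restrict_lt_iff, Set.preimage_ofPred_eq] using h

theorem Place.valued_sub {V : SmoothProjectiveVariety F} (v : V.Place) (a b : V.FunctionField) :
    Valued.v ((a : v.Completion) - (b : v.Completion)) = v.valuation (a - b) := by
  rw [← IsDedekindDomain.HeightOneSpectrum.valuedAdicCompletion_eq_valuation' v.prime (a - b)]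
  congr 1
  rw [sub_eq_iff_eq_add, ← IsDedekindDomain.HeightOneSpectrum.adicCompletion.coe_add,
    sub_add_cancel]

end SmoothProjectiveVariety

theorem mainTheorem10 (p : ℕ) [Fact p.Prime]
    (F : Type u) [Field F] [Algebra (RatFunc (ZMod p)) F]
    [FiniteDimensional (RatFunc (ZMod p)) F]
    (V : SmoothProjectiveVariety F)
    (Ω₁ : Set V.Place) (hΩ₁ : Ω₁ᶜ.Finite)
    (Γ : Set V.FunctionField) (hΓ : ∀ x ∈ Γ, ∀ v ∈ Ω₁, v.IsIntegralAt x)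
    (y : V.Adele) (hy : y ∈ closure (V.diagonal '' Γ))
    (y₀ : V.FunctionField)
    (hy₀ : ∀ v ∈ Ω₁, y v = (y₀ : v.Completion)) :
    (∀ v : V.Place, y v = (y₀ : v.Completion)) ∧ y = V.diagonal y₀ := by
  suffices h : ∀ v : V.Place, y v = (y₀ : v.Completion) from ⟨h, Subtype.ext (funext h)⟩
  have : Infinite F := .of_injective _
    ((algebraMap (RatFunc (ZMod p)) F).injective.comp (RatFunc.algebraMap_injective (ZMod p)))
  obtain ⟨_, n, s, hs⟩ := V.exists_isProjectiveModel
  obtain ⟨m, z, hz⟩ := hs.exists_isNormalizedModel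
  intro v₀
  by_contra hv₀
  have : Nonempty V.Place := ⟨v₀⟩
  obtain ⟨w, hw⟩ := hz.exists_notMem_finset hΩ₁.toFinset
  have hw : w ∈ Ω₁ := by simpa using hw
  have hS := hΩ₁.union (V.finite_poles y₀)
  -- The pole bound comes from `x - y₀ = (x - y) + (y - y₀)`, with the first term of value less than
  -- `1`.
  obtain ⟨N, hN⟩ := hz.exists_forall_eq_zero w hS.toFinset
    fun v ↦ max 1 (Valued.v (y v - (y₀ : v.Completion)))
  let U (v : V.Place) (γ : WithZero (Multiplicative ℤ)) : Set V.Adele :=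
    {x | Valued.v (x v - y v) < γ}
  have hU : ∀ v γ, IsOpen (U v γ) := fun v γ ↦
    (v.isOpen_ball (y v) γ).preimage (RestrictedProduct.continuous_eval v)
  have hyU : ∀ v γ, γ ≠ 0 → y ∈ U v γ := fun v γ hγ ↦ by
    change Valued.v (y v - y v) < γ
    rw [sub_self, map_zero]
    exact zero_lt_iff.2 hγ
  have hv₀' : Valued.v (y v₀ - (y₀ : v₀.Completion)) ≠ 0 := by
    rwa [Valuation.ne_zero_iff, sub_ne_zero]
  -- The three conditions bound the poles of `x - y₀`, make it vanish to order at least `N` at `w`,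
  -- and keep `x` away from `y₀` at `v₀`.
  obtain ⟨_, ⟨⟨hxS, hxw⟩, hxv₀⟩, x, hx, rfl⟩ := mem_closure_iff.1 hy
    (((⋂ v ∈ hS.toFinset, U v 1) ∩ U w (WithZero.exp (-(N : ℤ)))) ∩
      U v₀ (Valued.v (y v₀ - (y₀ : v₀.Completion))))
    (((isOpen_biInter_finset fun v _ ↦ hU v 1).inter (hU _ _)).inter (hU _ _))
    ⟨⟨Set.mem_iInter₂.2 fun v _ ↦ hyU v 1 one_ne_zero, hyU _ _ WithZero.exp_ne_zero⟩,
      hyU _ _ hv₀'⟩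
  have hx0 : x - y₀ = 0 := by
    refine hN _ (fun v hv ↦ ?_) (fun v hv ↦ ?_) ?_
    · rw [Set.Finite.mem_toFinset, Set.mem_union, not_or, Set.notMem_compl_iff] at hv
      exact Valuation.map_sub_le _ (hΓ x hx v hv.1) (not_not.1 hv.2)
    · have h1 : Valued.v ((x : v.Completion) - y v) < 1 := Set.mem_iInter₂.1 hxS v hv
      rw [← v.valued_sub, ← sub_add_sub_cancel _ (y v)]
      exact (Valuation.map_add _ _ _).trans (max_le_max h1.le le_rfl)
    · have h1 : Valued.v ((x : w.Completion) - y w) < _ := hxw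
      rw [hy₀ w hw, w.valued_sub] at h1
      exact h1.le
  obtain rfl := sub_eq_zero.1 hx0
  have h1 : Valued.v ((x : v₀.Completion) - y v₀) < Valued.v (y v₀ - (x : v₀.Completion)) := hxv₀
  rw [Valuation.map_sub_swap] at h1
  exact lt_irrefl _ h1
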